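/- Let $n\ge 1$ and let $K\subset\mathbb{R}^n$ be a convex body (a compact convex set with non-empty interior), with support function $h_K(x)=\max\{\langle x,y\rangle:y\in K\}$. For a unit vector $u$ let $\tau(K,\{u\})$ be the set of boundary points $x$ of $K$ with $\langle x,u\rangle=h_K(u)$; call $u$ a regular normal vector if $\tau(K,\{u\})$ is a single point, and denote that point by $\tau_K(u)$. For $i\in\mathbb{N}^+$ let $$A_i=\{u\in S^{n-1}:\ K\subset B[x-iu,i]\text{ for some }x\in\tau(K,\{u\})\},$$ where $B[x,r]$ is the closed ball of radius $r$ centred at $x$. Every $u\in A_i$ is a regular normal vector; let $\tau_i=\tau_K|_{A_i}$. A function $f:\mathbb{R}^n\to\mathbb{R}$ is second order differentiable at $x_0$ in the generalized sense if it is differentiable at $x_0$ and there is a symmetric linear map $Af(x_0):\mathbb{R}^n\to\mathbb{R}^n$ with $f(y)=f(x_0)+\langle\nabla f(x_0),y-x_0\rangle+\frac12\langle Af(x_0)(y-x_0),y-x_0\rangle+o(\|y-x_0\|^2)$ as $y\to x_0$. Let $D^2(h_K)$ be the set of points where $h_K$ has this property. For $u\in D^2(h_K)\cap S^{n-1}$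 the subspace $u^\perp$ is invariant under $Ah_K(u)$, and the generalized curvature function is $F_K(u)=\det\left(Ah_K(u)|_{u^\perp}\right)$. For a measure $\eta$ on $\mathbb{R}^n$, a point $a$, and $m=n-1$, put $\Theta^{m}(\eta,a)=\lim_{r\to0+}\omega_m^{-1}r^{-m}\eta(B(a,r))$ if the limit exists, where $B(a,r)$ is the open ball and $\omega_m$ is the volume of the $m$-dimensional unit ball. Let $\mathrm{Tan}(S,a)$ be the set of $v$ such that for every $\varepsilon>0$ there are $x\in S$, $r>0$ with $\|x-a\|<\varepsilon$ and $\|r(x-a)-v\|<\varepsilon$, and let $\mathrm{Tan}^m(\eta,a)=\bigcap\{\mathrm{Tan}(S,a):\Theta^m(\eta\llcorner(\mathbb{R}^n\setminus S),a)=0\}$. A map $f$ from a subset of $\mathbb{R}^n$ to $\mathbb{R}^n$ is $(\eta,m)$ approximately differentiable at $a$ if there are $\xi\in\mathbb{R}^n$ and a linear map $\zeta:\mathbb{R}^n\to\mathbb{R}^n$ with $\Theta^m\left(\eta\llcorner(\mathbb{R}^n\setminus\{x:\|f(x)-\xi-\zeta(x-a)\|\le\varepsilon\|x-a\|\}),a\right)=0$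 for every $\varepsilon>0$; its approximate differential is then $(\eta,m)\,\mathrm{ap}\,Df(a)=\zeta|_{\mathrm{Tan}^m(\eta,a)}$. If moreover $\mathrm{Tan}^m(\eta,a)$ is an $m$-dimensional linear subspace, the approximate Jacobian $(\eta,m)\,\mathrm{ap}\,Jf(a)$ is the operator norm of $\bigwedge^m (\eta,m)\,\mathrm{ap}\,Df(a)$, for the induced inner products on the exterior powers. Then for each $i\in\mathbb{N}^+$ and for $\mathcal{H}^{n-1}$-almost every $u\in A_i$: $u$ is a regular normal vector, $u\in D^2(h_K)$, the cone $\mathrm{Tan}^{n-1}(\mathcal{H}^{n-1}\llcorner A_i,u)$ is an $(n-1)$-dimensional linear subspace, $\tau_i$ is $(\mathcal{H}^{n-1}\llcorner A_i,n-1)$ approximately differentiable at $u$ (so both sides below are defined), and $$(\mathcal{H}^{n-1}\llcorner A_i,n-1)\,\mathrm{ap}\,J\tau_i(u)=F_K(u).$$ -/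

import Mathlib

open MeasureTheory Topology Filter Asymptotics Metric

noncomputable section

namespace AffineSurface

variable {n : ℕ}

/-! ### Convex bodies: support function, normals, inverse Gauss map -/

/-- The support function `h_K(x) = max {⟨x, y⟩ : y ∈ K}` (the supremum is attained when `K` is
compact and nonempty). -/
def supportFun (K : Set (EuclideanSpace ℝ (Fin n))) (x : EuclideanSpace ℝ (Fin n)) : ℝ :=
  sSup ((fun y => inner ℝ x y) '' K)

/-- The supporting hyperplane `P(K, u) = {x : ⟨x, u⟩ = h_K(u)}`. -/
def supportingHyperplane (K : Set (EuclideanSpace ℝ (Fin n))) (u : EuclideanSpace ℝ (Fin n)) :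
    Set (EuclideanSpace ℝ (Fin n)) :=
  {x | inner ℝ x u = supportFun K u}

/-- `u` is an outer unit normal of `K` at the boundary point `x`. -/
def IsOuterUnitNormal (K : Set (EuclideanSpace ℝ (Fin n))) (x u : EuclideanSpace ℝ (Fin n)) :
    Prop :=
  x ∈ frontier K ∧ ‖u‖ = 1 ∧ x ∈ supportingHyperplane K u

/-- The inverse spherical image `τ(K, ω)`: all boundary points of `K` that have an outer unit
normal vector in `ω`. -/
def inverseSphericalImage (K ω : Set (EuclideanSpace ℝ (Fin n))) :
    Set (EuclideanSpace ℝ (Fin n)) :=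
  {x | ∃ u ∈ ω, IsOuterUnitNormal K x u}

/-- The set `regn K` of regular normal vectors: the unit vectors `u` for which `τ(K, {u})` consists
of exactly one point. -/
def regularNormals (K : Set (EuclideanSpace ℝ (Fin n))) : Set (EuclideanSpace ℝ (Fin n)) :=
  {u | ‖u‖ = 1 ∧ ∃! x, x ∈ inverseSphericalImage K {u}}

open Classical in
/-- The inverse Gauss map `τ_K`, sending a regular normal vector `u` to the unique point of
`τ(K, {u})`. It is extended by `0` off its domain `regn K`. -/
def inverseGaussMap (K : Set (EuclideanSpace ℝ (Fin n))) (u : EuclideanSpace ℝ (Fin n)) :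
    EuclideanSpace ℝ (Fin n) :=
  if h : u ∈ regularNormals K then h.2.choose else 0

/-- The set `A_i` of all unit vectors `u` such that `K ⊆ B[x - i u, i]` for some `x ∈ τ(K, {u})`. -/
def enclosedSet (K : Set (EuclideanSpace ℝ (Fin n))) (i : ℕ) : Set (EuclideanSpace ℝ (Fin n)) :=
  {u | ‖u‖ = 1 ∧ ∃ x ∈ inverseSphericalImage K {u}, K ⊆ closedBall (x - (i : ℝ) • u) (i : ℝ)}

/-! ### Generalized second order differentiability and the generalized curvature function -/

/-- `f` is second order differentiable at `x₀` in the generalized sense, with the symmetric linear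
map `A` as its second derivative: `f` is differentiable at `x₀` and
`f y = f x₀ + ⟨∇f(x₀), y - x₀⟩ + ½ ⟨A (y - x₀), y - x₀⟩ + o(‖y - x₀‖²)`. -/
def HasGenHessianAt (f : EuclideanSpace ℝ (Fin n) → ℝ)
    (A : EuclideanSpace ℝ (Fin n) →ₗ[ℝ] EuclideanSpace ℝ (Fin n))
    (x₀ : EuclideanSpace ℝ (Fin n)) : Prop :=
  DifferentiableAt ℝ f x₀ ∧ A.IsSymmetric ∧
    (fun y => f y - (f x₀ + inner ℝ (gradient f x₀) (y - x₀)
      + 1 / 2 * inner ℝ (A (y - x₀)) (y - x₀))) =o[𝓝 x₀] (fun y => ‖y - x₀‖ ^ 2)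

/-- The set `D²(f)` of all points at which `f` is second order differentiable in the generalized
sense. -/
def secondOrderDiffSet (f : EuclideanSpace ℝ (Fin n) → ℝ) : Set (EuclideanSpace ℝ (Fin n)) :=
  {x₀ | ∃ A, HasGenHessianAt f A x₀}

open Classical in
/-- The (unique) symmetric linear map `Af(x₀)` at a point `x₀ ∈ D²(f)`; it is `0` elsewhere. -/
def genHessian (f : EuclideanSpace ℝ (Fin n) → ℝ) (x₀ : EuclideanSpace ℝ (Fin n)) :
    EuclideanSpace ℝ (Fin n) →ₗ[ℝ] EuclideanSpace ℝ (Fin n) :=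
  if h : x₀ ∈ secondOrderDiffSet f then h.choose else 0

open Classical in
/-- The generalized curvature function `F_K(u)`: the determinant of the restriction of `Ah_K(u)` to
its invariant subspace `u^⊥`. It is meaningful for unit vectors `u ∈ D²(h_K)`, for which `u^⊥` is
always invariant. -/
def curvatureFun (K : Set (EuclideanSpace ℝ (Fin n))) (u : EuclideanSpace ℝ (Fin n)) : ℝ :=
  if h : ∀ x ∈ (ℝ ∙ u)ᗮ, genHessian (supportFun K) u x ∈ (ℝ ∙ u)ᗮ then
    LinearMap.det ((genHessian (supportFun K) u).restrict h)
  else 0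

/-! ### Densities, approximate tangent cones, approximate differentials and Jacobians -/

/-- The `m`-dimensional density `Θ^m(η, a) = lim_{r → 0+} η(B(a, r)) / (ω_m r^m)` exists and equals
`θ`, where `ω_m` is the volume of the `m`-dimensional Euclidean unit ball. -/
def HasDensity (η : Measure (EuclideanSpace ℝ (Fin n))) (m : ℕ) (a : EuclideanSpace ℝ (Fin n))
    (θ : ENNReal) : Prop :=
  Tendsto (fun r : ℝ => η (ball a r) /
    (volume (ball (0 : EuclideanSpace ℝ (Fin m)) 1) * ENNReal.ofReal (r ^ m))) (𝓝[>] 0) (𝓝 θ)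

/-- The tangent cone `Tan(S, a)`. -/
def tangentCone (S : Set (EuclideanSpace ℝ (Fin n))) (a : EuclideanSpace ℝ (Fin n)) :
    Set (EuclideanSpace ℝ (Fin n)) :=
  {v | ∀ ε > 0, ∃ x ∈ S, ∃ r : ℝ, 0 < r ∧ ‖x - a‖ < ε ∧ ‖r • (x - a) - v‖ < ε}

/-- The `(η, m)` approximate tangent cone `Tan^m(η, a)`: the intersection of the cones `Tan(S, a)`
over all sets `S` such that `η` restricted to the complement of `S` has `m`-density `0` at `a`. -/
def approxTangentCone (η : Measure (EuclideanSpace ℝ (Fin n))) (m : ℕ)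
    (a : EuclideanSpace ℝ (Fin n)) : Set (EuclideanSpace ℝ (Fin n)) :=
  {v | ∀ S : Set (EuclideanSpace ℝ (Fin n)), HasDensity (η.restrict Sᶜ) m a 0 → v ∈ tangentCone S a}

/-- The linear span of the approximate tangent cone; it is the cone itself when the latter is a
linear subspace. -/
def approxTangentSpace (η : Measure (EuclideanSpace ℝ (Fin n))) (m : ℕ)
    (a : EuclideanSpace ℝ (Fin n)) : Submodule ℝ (EuclideanSpace ℝ (Fin n)) :=
  Submodule.span ℝ (approxTangentCone η m a)

/-- The approximate tangent cone `Tan^m(η, a)` is an `m`-dimensional linear subspace. -/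
def ApproxTangentConeIsSubspace (η : Measure (EuclideanSpace ℝ (Fin n))) (m : ℕ)
    (a : EuclideanSpace ℝ (Fin n)) : Prop :=
  ∃ V : Submodule ℝ (EuclideanSpace ℝ (Fin n)),
    Module.finrank ℝ V = m ∧ (V : Set (EuclideanSpace ℝ (Fin n))) = approxTangentCone η m a

/-- The map `f`, regarded as a map with domain `D`, is `(η, m)` approximately differentiable at `a`
with linear part `ζ`. -/
def HasApproxDerivAt (η : Measure (EuclideanSpace ℝ (Fin n))) (m : ℕ)
    (D : Set (EuclideanSpace ℝ (Fin n))) (f : EuclideanSpace ℝ (Fin n) → EuclideanSpace ℝ (Fin n))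
    (a : EuclideanSpace ℝ (Fin n))
    (ζ : EuclideanSpace ℝ (Fin n) →L[ℝ] EuclideanSpace ℝ (Fin n)) : Prop :=
  ∃ ξ : EuclideanSpace ℝ (Fin n), ∀ ε : ℝ, 0 < ε →
    HasDensity (η.restrict {x | x ∈ D ∧ ‖f x - ξ - ζ (x - a)‖ ≤ ε * ‖x - a‖}ᶜ) m a 0

/-- `f`, regarded as a map with domain `D`, is `(η, m)` approximately differentiable at `a`. -/
def ApproxDifferentiableAt (η : Measure (EuclideanSpace ℝ (Fin n))) (m : ℕ)
    (D : Set (EuclideanSpace ℝ (Fin n))) (f : EuclideanSpace ℝ (Fin n) → EuclideanSpace ℝ (Fin n))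
    (a : EuclideanSpace ℝ (Fin n)) : Prop :=
  ∃ ζ, HasApproxDerivAt η m D f a ζ

open Classical in
/-- The `(η, m)` approximate differential of `f : D → ℝⁿ` at `a`: the restriction `ζ|_{Tan^m(η, a)}`
of any `ζ` as in `HasApproxDerivAt` (all of them agree on the approximate tangent cone). It is `0`
if `f` is not approximately differentiable at `a`. -/
def approxDifferential (η : Measure (EuclideanSpace ℝ (Fin n))) (m : ℕ)
    (D : Set (EuclideanSpace ℝ (Fin n))) (f : EuclideanSpace ℝ (Fin n) → EuclideanSpace ℝ (Fin n))
    (a : EuclideanSpace ℝ (Fin n)) :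
    approxTangentSpace η m a →ₗ[ℝ] EuclideanSpace ℝ (Fin n) :=
  if h : ApproxDifferentiableAt η m D f a then
    (h.choose : EuclideanSpace ℝ (Fin n) →ₗ[ℝ] EuclideanSpace ℝ (Fin n)).domRestrict
      (approxTangentSpace η m a)
  else 0

/-- The operator norm `‖⋀^m f‖` of the map induced by `f` between the `m`-th exterior powers with
their induced inner products. -/
def exteriorPowerNorm {V W : Type*} [NormedAddCommGroup V] [InnerProductSpace ℝ V]
    [FiniteDimensional ℝ V] [NormedAddCommGroup W] [InnerProductSpace ℝ W] [FiniteDimensional ℝ W]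
    (m : ℕ) (f : V →ₗ[ℝ] W) : ℝ :=
  ‖LinearMap.toContinuousLinearMap (exteriorPower.map m f)‖

/-- The `(η, m)` approximate Jacobian of `f : D → ℝⁿ` at `a`: the operator norm of the map induced
by the approximate differential on the `m`-th exterior powers, with their induced inner products.
It is meaningful when `ApproxTangentConeIsSubspace η m a` and `ApproxDifferentiableAt η m D f a`. -/
def approxJacobian (η : Measure (EuclideanSpace ℝ (Fin n))) (m : ℕ)
    (D : Set (EuclideanSpace ℝ (Fin n))) (f : EuclideanSpace ℝ (Fin n) → EuclideanSpace ℝ (Fin n))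
    (a : EuclideanSpace ℝ (Fin n)) : ℝ :=
  exteriorPowerNorm m (approxDifferential η m D f a)

end AffineSurface

end

/-!
For `u ∈ A_i`, the contact point `x = τ_K(u)` satisfies `‖q - x‖² ≤ 2 i ⟨u, x - q⟩` on `K`. If `p ∈ K`
maximizes `⟨y, ·⟩` for an arbitrary vector `y`, then adding the inequality `⟨y, x - p⟩ ≤ 0` gives
`‖p - x‖ ≤ 2 i ‖u - y‖` (`norm_sub_inverseGaussMap_le`). So `τ_K` is Lipschitz on the compact set
`A_i`, and the subdifferential of `h_K` at points near `A_i` is controlled by the values of `τ_K` on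
`A_i`. This replaces Alexandrov's theorem on the second differentiability of convex functions.

The central projection of a tangent hyperplane onto an open hemisphere is `1`-Lipschitz with a
locally Lipschitz inverse. Hence null sets and sets of density zero can be moved between
the sphere and Euclidean `(n - 1)`-space, and the theorems of Rademacher and Lebesgue apply there.
They show (`ae_isRegularPoint`) that at almost every `u ∈ A_i` the map `τ_K` is differentiable within
`A_i`, and that `A_i ∩ S` is asymptotically dense in the sphere whenever `A_i \ S` has density zero
at `u`.

At such a point every subgradient `p` of `h_K` at a nearby `y` is compared with `τ_K(z)`, where
`z ∈ A_i` is `o(‖y - u‖)`-close to `y / ‖y‖`; this gives `p = x + B (y - u) + o(‖y - u‖)` for a linear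
map `B` (`exists_hasSupportPointDeriv`). Integrating along segments, `B` is the generalized second
derivative of `h_K` at `u`; the subgradient inequality makes it symmetric and positive, and
homogeneity gives `B u = 0`. By asymptotic density the approximate tangent cone is `u^⊥`, and there
the approximate differential of `τ_K` must agree with `B`. On the top exterior power of `u^⊥` the norm
is the absolute value of the determinant of `B` restricted to `u^⊥`, which is nonnegative because `B`
is positive.
-/

namespace AffineSurface

variable {n : ℕ}

/-! ### Support points and enclosing balls -/

/-- `p` is a point of `K` at which the linear functional `⟨y, ·⟩` attains its maximum over `K`;
equivalently, `p` is a subgradient at `y` of the support function of `K`. No condition is put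
on `y`, which may even be `0`. -/
def IsSupportPoint (K : Set (EuclideanSpace ℝ (Fin n))) (y p : EuclideanSpace ℝ (Fin n)) : Prop :=
  p ∈ K ∧ ∀ q ∈ K, inner ℝ y q ≤ inner ℝ y p

section SupportPoint

variable {K : Set (EuclideanSpace ℝ (Fin n))}

theorem exists_isSupportPoint (hK : IsCompact K) (hne : K.Nonempty)
    (y : EuclideanSpace ℝ (Fin n)) : ∃ p, IsSupportPoint K y p := by
  obtain ⟨p, hp, hmax⟩ := hK.exists_isMaxOn hne
    (f := fun q => inner ℝ y q) (by fun_prop)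
  exact ⟨p, hp, fun q hq => hmax hq⟩

theorem IsSupportPoint.supportFun_eq {y p : EuclideanSpace ℝ (Fin n)} (h : IsSupportPoint K y p) :
    supportFun K y = inner ℝ y p :=
  IsGreatest.csSup_eq ⟨⟨p, h.1, rfl⟩, by rintro _ ⟨q, hq, rfl⟩; exact h.2 q hq⟩

theorem inner_le_supportFun (hK : IsCompact K) {p : EuclideanSpace ℝ (Fin n)} (hp : p ∈ K)
    (y : EuclideanSpace ℝ (Fin n)) : inner ℝ y p ≤ supportFun K y := by
  obtain ⟨q, hq⟩ := exists_isSupportPoint hK ⟨p, hp⟩ y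
  rw [hq.supportFun_eq]
  exact hq.2 p hp

/-- A support point at `y` is a subgradient of the support function at `y`. -/
theorem IsSupportPoint.le_sub (hK : IsCompact K) {y p : EuclideanSpace ℝ (Fin n)}
    (h : IsSupportPoint K y p) (z : EuclideanSpace ℝ (Fin n)) :
    inner ℝ p (z - y) ≤ supportFun K z - supportFun K y := by
  have := inner_le_supportFun hK h.1 z
  rw [h.supportFun_eq, inner_sub_right, real_inner_comm z p, real_inner_comm y p]
  linarith

theorem IsSupportPoint.smul {y p : EuclideanSpace ℝ (Fin n)} (h : IsSupportPoint K y p) {t : ℝ}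
    (ht : 0 ≤ t) : IsSupportPoint K (t • y) p := by
  refine ⟨h.1, fun q hq => ?_⟩
  rw [real_inner_smul_left, real_inner_smul_left]
  exact mul_le_mul_of_nonneg_left (h.2 q hq) ht

theorem mem_inverseSphericalImage_singleton (hK : IsCompact K)
    {u x : EuclideanSpace ℝ (Fin n)} :
    x ∈ inverseSphericalImage K {u} ↔ ‖u‖ = 1 ∧ IsSupportPoint K u x := by
  constructor
  · rintro ⟨v, hv, hx, hu, hs⟩
    obtain rfl : v = u := hv
    have hxK : x ∈ K := hK.isClosed.frontier_subset hx
    refine ⟨hu, hxK, fun q hq => ?_⟩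
    have h1 := inner_le_supportFun hK hq v
    have h2 : inner ℝ x v = supportFun K v := hs
    rw [real_inner_comm] at h2
    linarith
  · rintro ⟨hu, h⟩
    refine ⟨u, rfl, ?_, hu, ?_⟩
    · rw [hK.isClosed.frontier_eq]
      refine ⟨h.1, fun hint => ?_⟩
      -- an interior maximum point could be pushed further in the direction `u`
      obtain ⟨ε, hε, hball⟩ := Metric.mem_nhds_iff.1 (mem_interior_iff_mem_nhds.1 hint)
      have hmem : x + (ε / 2) • u ∈ K := by
        apply hball
        rw [mem_ball, dist_eq_norm, add_sub_cancel_left, norm_smul, hu, Real.norm_eq_abs,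
          abs_of_pos (half_pos hε)]
        linarith
      have := h.2 _ hmem
      rw [inner_add_right, real_inner_smul_right, real_inner_self_eq_norm_sq, hu] at this
      linarith
    · change inner ℝ x u = supportFun K u
      rw [h.supportFun_eq, real_inner_comm]

/-- The enclosing ball condition, expanded: it bounds the squared distance to the contact point by
the height below the supporting hyperplane. -/
theorem subset_closedBall_sub_smul_iff {u x : EuclideanSpace ℝ (Fin n)} (hu : ‖u‖ = 1) (i : ℕ) :
    K ⊆ closedBall (x - (i : ℝ) • u) (i : ℝ) ↔
      ∀ q ∈ K, ‖q - x‖ ^ 2 ≤ 2 * i * inner ℝ u (x - q) := by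
  have key : ∀ q, q ∈ closedBall (x - (i : ℝ) • u) (i : ℝ) ↔
      ‖q - x‖ ^ 2 ≤ 2 * i * inner ℝ u (x - q) := by
    intro q
    rw [mem_closedBall, dist_eq_norm, ← abs_of_nonneg (Nat.cast_nonneg (α := ℝ) i),
      ← abs_norm, ← sq_le_sq, abs_of_nonneg (Nat.cast_nonneg (α := ℝ) i)]
    have : q - (x - (i : ℝ) • u) = (q - x) + (i : ℝ) • u := by abel
    rw [this, norm_add_sq_real, norm_smul, hu, real_inner_smul_right, real_inner_comm u (q - x),
      ← neg_sub q x, inner_neg_right, Real.norm_natCast]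
    constructor <;> intro h <;> nlinarith
  exact ⟨fun h q hq => (key q).1 (h hq), fun h q hq => (key q).2 (h q hq)⟩

/-- Membership in the enclosed set without reference to the boundary of `K`: a point of `K` that
satisfies the quadratic bound is automatically a support point. -/
theorem mem_enclosedSet_iff (hK : IsCompact K) {u : EuclideanSpace ℝ (Fin n)} {i : ℕ}
    (hi : 1 ≤ i) :
    u ∈ enclosedSet K i ↔
      ‖u‖ = 1 ∧ ∃ x ∈ K, ∀ q ∈ K, ‖q - x‖ ^ 2 ≤ 2 * i * inner ℝ u (x - q) := by
  have hi' : (0 : ℝ) < i := by exact_mod_cast hi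
  refine and_congr_right fun hu => ⟨?_, ?_⟩
  · rintro ⟨x, hx, hb⟩
    exact ⟨x, ((mem_inverseSphericalImage_singleton hK).1 hx).2.1,
      (subset_closedBall_sub_smul_iff hu i).1 hb⟩
  · rintro ⟨x, hx, hb⟩
    refine ⟨x, (mem_inverseSphericalImage_singleton hK).2 ⟨hu, hx, fun q hq => ?_⟩,
      (subset_closedBall_sub_smul_iff hu i).2 hb⟩
    have h := (sq_nonneg _).trans (hb q hq)
    rw [inner_sub_right] at h
    have := nonneg_of_mul_nonneg_right h (by positivity)
    linarith

theorem isCompact_enclosedSet (hK : IsCompact K) {i : ℕ} (hi : 1 ≤ i) :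
    IsCompact (enclosedSet K i) := by
  set T : Set (EuclideanSpace ℝ (Fin n) × EuclideanSpace ℝ (Fin n)) :=
    (sphere 0 1 ×ˢ K) ∩
      ⋂ q ∈ K, {z | ‖q - z.2‖ ^ 2 ≤ 2 * i * inner ℝ z.1 (z.2 - q)} with hT
  have hTc : IsCompact T := by
    refine ((isCompact_sphere _ _).prod hK).inter_right ?_
    refine isClosed_biInter fun q _ => isClosed_le ?_ ?_ <;> fun_prop
  convert hTc.image continuous_fst
  ext u
  rw [mem_enclosedSet_iff hK hi]
  simp only [hT, Set.mem_image, Set.mem_inter_iff, Set.mem_prod, mem_sphere, dist_zero_right,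
    Set.mem_iInter, Set.mem_ofPred_eq, Prod.exists, exists_and_right, exists_eq_right]
  constructor
  · rintro ⟨hu, x, hx, h⟩
    exact ⟨x, ⟨hu, hx⟩, h⟩
  · rintro ⟨x, ⟨hu, hx⟩, h⟩
    exact ⟨hu, x, hx, h⟩

/-- A support point at an arbitrary vector `y` is within `2 i ‖u - y‖` of the contact point at
`u ∈ A_i`: one-sided Lipschitz continuity of the subdifferential of the support function. -/
theorem norm_sub_le_of_isSupportPoint {u x y p : EuclideanSpace ℝ (Fin n)} {i : ℕ}
    (hx : x ∈ K) (hb : ∀ q ∈ K, ‖q - x‖ ^ 2 ≤ 2 * i * inner ℝ u (x - q))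
    (hp : IsSupportPoint K y p) : ‖p - x‖ ≤ 2 * i * ‖u - y‖ := by
  have h1 := hb p hp.1
  have h2 := hp.2 x hx
  have h3 : inner ℝ u (x - p) ≤ ‖u - y‖ * ‖p - x‖ := by
    have := real_inner_le_norm (u - y) (x - p)
    rw [norm_sub_rev x p, inner_sub_left] at this
    have h4 : inner ℝ y (x - p) ≤ 0 := by rw [inner_sub_right]; linarith
    linarith
  by_contra! hlt
  have hpos : 0 < ‖p - x‖ := lt_of_le_of_lt (by positivity) hlt
  have hi0 : (0 : ℝ) ≤ i := Nat.cast_nonneg i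
  nlinarith [mul_le_mul_of_nonneg_left h3 hi0, mul_lt_mul_of_pos_right hlt hpos]

theorem enclosedSet_subset_regularNormals (hK : IsCompact K) {i : ℕ} (hi : 1 ≤ i) :
    enclosedSet K i ⊆ regularNormals K := by
  intro u hu
  obtain ⟨hu1, x, hx, hb⟩ := (mem_enclosedSet_iff hK hi).1 hu
  obtain ⟨-, x', hx', hb'⟩ := hu
  have hxs : ∀ z ∈ inverseSphericalImage K {u}, z = x := by
    intro z hz
    have := norm_sub_le_of_isSupportPoint hx hb ((mem_inverseSphericalImage_singleton hK).1 hz).2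
    rw [sub_self, norm_zero, mul_zero] at this
    exact sub_eq_zero.1 (norm_le_zero_iff.1 this)
  refine ⟨hu1, x', hx', fun z hz => ?_⟩
  rw [hxs z hz, hxs x' hx']

theorem inverseGaussMap_mem {u : EuclideanSpace ℝ (Fin n)} (hu : u ∈ regularNormals K) :
    inverseGaussMap K u ∈ inverseSphericalImage K {u} := by
  rw [inverseGaussMap, dif_pos hu]
  exact hu.2.choose_spec.1

theorem isSupportPoint_inverseGaussMap (hK : IsCompact K) {u : EuclideanSpace ℝ (Fin n)}
    (hu : u ∈ regularNormals K) : IsSupportPoint K u (inverseGaussMap K u) :=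
  ((mem_inverseSphericalImage_singleton hK).1 (inverseGaussMap_mem hu)).2

theorem norm_sub_inverseGaussMap_le (hK : IsCompact K) {i : ℕ} (hi : 1 ≤ i)
    {u y p : EuclideanSpace ℝ (Fin n)} (hu : u ∈ enclosedSet K i) (hp : IsSupportPoint K y p) :
    ‖p - inverseGaussMap K u‖ ≤ 2 * i * ‖u - y‖ := by
  have hreg := enclosedSet_subset_regularNormals hK hi hu
  obtain ⟨-, x, hx, hb⟩ := hu
  have : x = inverseGaussMap K u := hreg.2.unique hx (inverseGaussMap_mem hreg)
  subst this
  exact norm_sub_le_of_isSupportPoint ((mem_inverseSphericalImage_singleton hK).1 hx).2.1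
    ((subset_closedBall_sub_smul_iff hreg.1 i).1 hb) hp

theorem lipschitzOnWith_inverseGaussMap (hK : IsCompact K) {i : ℕ} (hi : 1 ≤ i) :
    LipschitzOnWith (2 * i) (inverseGaussMap K) (enclosedSet K i) := by
  refine LipschitzOnWith.of_dist_le_mul fun v hv u hu => ?_
  have := norm_sub_inverseGaussMap_le hK hi hu
    (isSupportPoint_inverseGaussMap hK (enclosedSet_subset_regularNormals hK hi hv))
  rw [dist_eq_norm, dist_eq_norm, norm_sub_rev v u]
  simpa using this

end SupportPoint

/-! ### Second order expansion of the support function -/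

/-- A function on `[0, 1]` with subgradients `q t` that are uniformly `η`-close to the affine
function `a + t b` increases by `a + b / 2` up to an error `η`. -/
theorem abs_sub_le_of_subgradient_bound {k q : ℝ → ℝ} {a b η : ℝ}
    (hk : ∀ s ∈ Set.Icc (0 : ℝ) 1, ∀ t ∈ Set.Icc (0 : ℝ) 1, q t * (s - t) ≤ k s - k t)
    (hq : ∀ t ∈ Set.Icc (0 : ℝ) 1, |q t - (a + t * b)| ≤ η) :
    |k 1 - k 0 - (a + b / 2)| ≤ η := by
  set g : ℝ → ℝ := fun t => k t - a * t - b * t ^ 2 / 2 with hg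
  have step : ∀ t ∈ Set.Icc (0 : ℝ) 1, ∀ s ∈ Set.Icc (0 : ℝ) 1, t ≤ s →
      |g s - g t| ≤ (s - t) * (η + |b| * (s - t) / 2) := by
    intro t ht s hs hts
    have h1 := hk s hs t ht
    have h2 := hk t ht s hs
    have h3 := abs_le.1 (hq t ht)
    have h4 := abs_le.1 (hq s hs)
    have hd : 0 ≤ s - t := sub_nonneg.2 hts
    have hb1 := mul_le_mul_of_nonneg_right (le_abs_self b) (mul_nonneg hd hd)
    have hb2 := mul_le_mul_of_nonneg_right (neg_abs_le b) (mul_nonneg hd hd)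
    have e1 := mul_le_mul_of_nonneg_right h3.1 hd
    have e2 := mul_le_mul_of_nonneg_right h4.2 hd
    simp only [hg]
    rw [abs_le]
    constructor <;> nlinarith
  -- telescoping over `N` equal pieces leaves only an error of order `1 / N` besides `η`
  have bound : ∀ N : ℕ, |g 1 - g 0| ≤ η + |b| / 2 * (1 / ((N : ℝ) + 1)) := by
    intro N
    have hN : (0 : ℝ) < (N : ℝ) + 1 := by positivity
    have hsum := Finset.sum_range_sub (fun j : ℕ => g ((j : ℝ) / ((N : ℝ) + 1))) (N + 1)
    have hlast : (((N + 1 : ℕ) : ℝ)) / ((N : ℝ) + 1) = 1 := by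
      push_cast
      exact div_self hN.ne'
    rw [hlast, Nat.cast_zero, zero_div] at hsum
    rw [← hsum]
    calc _ ≤ ∑ j ∈ Finset.range (N + 1), |g (((j + 1 : ℕ) : ℝ) / ((N : ℝ) + 1))
              - g ((j : ℝ) / ((N : ℝ) + 1))| := Finset.abs_sum_le_sum_abs _ _
      _ ≤ ∑ j ∈ Finset.range (N + 1), (1 / ((N : ℝ) + 1))
              * (η + |b| * (1 / ((N : ℝ) + 1)) / 2) := by
          refine Finset.sum_le_sum fun j hj => ?_
          have hjN : (j : ℝ) + 1 ≤ (N : ℝ) + 1 := by exact_mod_cast Finset.mem_range.1 hj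
          have hdiff : (((j + 1 : ℕ) : ℝ)) / ((N : ℝ) + 1) - (j : ℝ) / ((N : ℝ) + 1)
              = 1 / ((N : ℝ) + 1) := by
            push_cast
            ring
          have hle : (j : ℝ) / ((N : ℝ) + 1) ≤ (((j + 1 : ℕ) : ℝ)) / ((N : ℝ) + 1) := by
            rw [← sub_nonneg, hdiff]
            positivity
          have h0 : 0 ≤ (j : ℝ) / ((N : ℝ) + 1) := by positivity
          have h1 : (((j + 1 : ℕ) : ℝ)) / ((N : ℝ) + 1) ≤ 1 := by
            push_cast
            exact (div_le_one hN).2 hjN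
          have := step _ ⟨h0, hle.trans h1⟩ _ ⟨h0.trans hle, h1⟩ hle
          rwa [hdiff] at this
      _ = η + |b| / 2 * (1 / ((N : ℝ) + 1)) := by
          rw [Finset.sum_const, Finset.card_range, nsmul_eq_mul]
          push_cast
          field_simp
  have hlim : Tendsto (fun N : ℕ => η + |b| / 2 * (1 / ((N : ℝ) + 1))) atTop (𝓝 η) := by
    simpa using (tendsto_one_div_add_atTop_nhds_zero_nat (𝕜 := ℝ)).const_mul (|b| / 2)
      |>.const_add η
  have hfin := ge_of_tendsto' hlim bound
  have : g 1 - g 0 = k 1 - k 0 - (a + b / 2) := by simp only [hg]; ring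
  rwa [this] at hfin

/-- The subdifferential of the support function of `K` is differentiable at `u` with value `x` and
derivative `A`: uniformly over all support points `p` at `y`, one has
`p = x + A (y - u) + o(‖y - u‖)`. -/
def HasSupportPointDeriv (K : Set (EuclideanSpace ℝ (Fin n))) (u x : EuclideanSpace ℝ (Fin n))
    (A : EuclideanSpace ℝ (Fin n) →L[ℝ] EuclideanSpace ℝ (Fin n)) : Prop :=
  ∀ ε > 0, ∀ᶠ y in 𝓝 u, ∀ p, IsSupportPoint K y p → ‖p - x - A (y - u)‖ ≤ ε * ‖y - u‖

namespace HasSupportPointDeriv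

variable {K : Set (EuclideanSpace ℝ (Fin n))} {u x : EuclideanSpace ℝ (Fin n)}
  {A : EuclideanSpace ℝ (Fin n) →L[ℝ] EuclideanSpace ℝ (Fin n)}

theorem isSupportPoint (hK : IsCompact K) (hne : K.Nonempty) (h : HasSupportPointDeriv K u x A) :
    IsSupportPoint K u x := by
  obtain ⟨p, hp⟩ := exists_isSupportPoint hK hne u
  have := (h 1 one_pos).self_of_nhds p hp
  rw [sub_self, map_zero, sub_zero, norm_zero, mul_zero] at this
  rwa [sub_eq_zero.1 (norm_le_zero_iff.1 this)] at hp

/-- A first order expansion of the subgradients integrates to a second order expansion of the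
support function. -/
theorem eventually_abs_sub_le (hK : IsCompact K) (hne : K.Nonempty)
    (h : HasSupportPointDeriv K u x A) {ε : ℝ} (hε : 0 < ε) :
    ∀ᶠ y in 𝓝 u, |supportFun K y - (supportFun K u + inner ℝ x (y - u)
      + 1 / 2 * inner ℝ (A (y - u)) (y - u))| ≤ ε * ‖y - u‖ ^ 2 := by
  obtain ⟨δ, hδ, hball⟩ := Metric.eventually_nhds_iff_ball.1 (h ε hε)
  filter_upwards [ball_mem_nhds u hδ] with y hy
  choose P hP using exists_isSupportPoint hK hne
  set w := y - u with hw
  have hmem : ∀ t ∈ Set.Icc (0 : ℝ) 1, u + t • w ∈ ball u δ := by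
    intro t ht
    rw [mem_ball, dist_eq_norm] at hy ⊢
    rw [add_sub_cancel_left, norm_smul, Real.norm_eq_abs, abs_of_nonneg ht.1]
    exact (mul_le_of_le_one_left (norm_nonneg _) ht.2).trans_lt hy
  have key := abs_sub_le_of_subgradient_bound (k := fun t => supportFun K (u + t • w))
    (q := fun t => inner ℝ (P (u + t • w)) w) (a := inner ℝ x w) (b := inner ℝ (A w) w)
    (η := ε * ‖w‖ ^ 2) ?_ ?_
  · have e1 : u + (1 : ℝ) • w = y := by rw [hw]; module
    have e0 : u + (0 : ℝ) • w = u := by module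
    simp only [e1, e0] at key
    convert key using 2
    ring
  · intro s _ t _
    have := (hP (u + t • w)).le_sub hK (u + s • w)
    have e : u + s • w - (u + t • w) = (s - t) • w := by module
    rw [e, real_inner_smul_right] at this
    linarith
  · intro t ht
    have h1 := hball _ (hmem t ht) _ (hP (u + t • w))
    rw [add_sub_cancel_left, map_smul] at h1
    have h2 : inner ℝ (P (u + t • w)) w - (inner ℝ x w + t * inner ℝ (A w) w)
        = inner ℝ (P (u + t • w) - x - t • A w) w := by
      rw [inner_sub_left, inner_sub_left, real_inner_smul_left]
      ring
    rw [h2]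
    calc |inner ℝ (P (u + t • w) - x - t • A w) w|
        ≤ ‖P (u + t • w) - x - t • A w‖ * ‖w‖ := abs_real_inner_le_norm _ _
      _ ≤ (ε * ‖t • w‖) * ‖w‖ := by gcongr
      _ ≤ ε * ‖w‖ ^ 2 := by
        rw [norm_smul, Real.norm_eq_abs, abs_of_nonneg ht.1]
        have : t * (ε * ‖w‖ ^ 2) ≤ ε * ‖w‖ ^ 2 :=
          mul_le_of_le_one_left (by positivity) ht.2
        linarith

theorem hasGradientAt (hK : IsCompact K) (hne : K.Nonempty) (h : HasSupportPointDeriv K u x A) :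
    HasGradientAt (supportFun K) x u := by
  rw [hasGradientAt_iff_isLittleO]
  have hbig : (fun y => supportFun K y - supportFun K u - inner ℝ x (y - u))
      =O[𝓝 u] fun y => ‖y - u‖ ^ 2 := by
    refine IsBigO.of_bound (1 + ‖A‖ / 2) ?_
    filter_upwards [h.eventually_abs_sub_le hK hne one_pos] with y hy
    have h1 : |inner ℝ (A (y - u)) (y - u)| ≤ ‖A‖ * ‖y - u‖ ^ 2 := by
      calc |inner ℝ (A (y - u)) (y - u)| ≤ ‖A (y - u)‖ * ‖y - u‖ := abs_real_inner_le_norm _ _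
        _ ≤ (‖A‖ * ‖y - u‖) * ‖y - u‖ := by gcongr; exact A.le_opNorm _
        _ = _ := by ring
    rw [Real.norm_eq_abs, Real.norm_eq_abs, abs_of_nonneg (sq_nonneg ‖y - u‖)]
    rw [abs_le] at *
    constructor <;> linarith [h1.1, h1.2, hy.1, hy.2]
  refine hbig.trans_isLittleO ?_
  have h0 : Tendsto (fun y : EuclideanSpace ℝ (Fin n) => y - u) (𝓝 u) (𝓝 0) := by
    have : Tendsto (fun y : EuclideanSpace ℝ (Fin n) => y - u) (𝓝 u) (𝓝 (u - u)) :=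
      (continuous_id.sub continuous_const).tendsto u
    rwa [sub_self] at this
  exact ((isLittleO_norm_pow_id one_lt_two).comp_tendsto h0)

/-- The Hessian inequality from which both symmetry and positivity of `A` follow. -/
theorem inner_sub_inner_add_nonneg (hK : IsCompact K) (hne : K.Nonempty)
    (h : HasSupportPointDeriv K u x A) (v w : EuclideanSpace ℝ (Fin n)) :
    0 ≤ inner ℝ (A w) v - inner ℝ (A v) w + inner ℝ (A w) w := by
  set C : ℝ := ‖v‖ * ‖w‖ + ‖v + w‖ ^ 2 + ‖v‖ ^ 2 with hC
  have hC0 : 0 ≤ C := by positivity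
  have tend : ∀ z : EuclideanSpace ℝ (Fin n),
      Tendsto (fun s : ℝ => u + s • z) (𝓝[>] 0) (𝓝 u) := by
    intro z
    have : Tendsto (fun s : ℝ => u + s • z) (𝓝 0) (𝓝 (u + (0 : ℝ) • z)) :=
      (Continuous.tendsto (by fun_prop) 0)
    rw [zero_smul, add_zero] at this
    exact this.mono_left nhdsWithin_le_nhds
  have main : ∀ ε > 0, -(2 * (ε * C)) ≤
      inner ℝ (A w) v - inner ℝ (A v) w + inner ℝ (A w) w := by
    intro ε hε
    have h2 := h.eventually_abs_sub_le hK hne hε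
    obtain ⟨s, ⟨⟨h1, h2⟩, h3⟩, hs⟩ := ((((tend v).eventually (h ε hε)).and
      ((tend v).eventually h2)).and ((tend (v + w)).eventually h2)).and
      self_mem_nhdsWithin |>.exists
    have hs : 0 < s := hs
    obtain ⟨p, hp⟩ := exists_isSupportPoint hK hne (u + s • v)
    have h1 := h1 p hp
    have h4 := hp.le_sub hK (u + s • (v + w))
    have e : u + s • (v + w) - (u + s • v) = s • w := by module
    rw [e, real_inner_smul_right, smul_add] at h4
    simp only [add_sub_cancel_left, map_smul, map_add, norm_smul, Real.norm_eq_abs,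
      abs_of_pos hs, real_inner_smul_right, real_inner_smul_left, inner_add_left,
      inner_add_right, smul_add] at h1 h2 h3
    have e2 : ‖s • v + s • w‖ = s * ‖v + w‖ := by
      rw [← smul_add, norm_smul, Real.norm_eq_abs, abs_of_pos hs]
    rw [e2] at h3
    have h5 : -(ε * (s * ‖v‖) * ‖w‖) ≤ inner ℝ p w - inner ℝ x w - s * inner ℝ (A v) w := by
      have : inner ℝ p w - inner ℝ x w - s * inner ℝ (A v) w = inner ℝ (p - x - s • A v) w := by
        rw [inner_sub_left, inner_sub_left, real_inner_smul_left]
      rw [this]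
      refine le_trans (neg_le_neg ?_) (neg_le_of_abs_le (abs_real_inner_le_norm _ _))
      gcongr
    have h2 := (abs_le.1 h2).1
    have h3 := (abs_le.1 h3).2
    have h6 := mul_le_mul_of_nonneg_left h5 hs.le
    have hs2 : 0 < s ^ 2 := by positivity
    refine le_of_mul_le_mul_left ?_ hs2
    rw [hC]
    linarith
  refine le_of_forall_pos_le_add fun η hη => ?_
  have := main (η / (2 * (C + 1))) (by positivity)
  have h7 : 2 * (η / (2 * (C + 1)) * C) ≤ η := by
    rw [show 2 * (η / (2 * (C + 1)) * C) = η * C / (C + 1) by field_simp, div_le_iff₀ (by linarith)]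
    nlinarith
  linarith

theorem isSymmetric (hK : IsCompact K) (hne : K.Nonempty) (h : HasSupportPointDeriv K u x A) :
    (A : EuclideanSpace ℝ (Fin n) →ₗ[ℝ] EuclideanSpace ℝ (Fin n)).IsSymmetric := by
  intro v w
  change inner ℝ (A v) w = inner ℝ v (A w)
  rw [real_inner_comm (A w) v]
  -- the inequality is affine in a multiple of `v`, so its linear part vanishes
  set c := inner ℝ (A w) v - inner ℝ (A v) w with hc
  set d := inner ℝ (A w) w with hd
  have hT : ∀ T : ℝ, 0 ≤ T * c + d := by
    intro T
    have := h.inner_sub_inner_add_nonneg hK hne (T • v) w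
    rw [map_smul, real_inner_smul_left, real_inner_smul_right] at this
    rw [hc, hd]
    linarith
  have hc0 : c = 0 := by
    by_contra hne
    have := hT (-(d + 1) / c)
    rw [div_mul_cancel₀ _ hne] at this
    linarith
  linarith

theorem inner_nonneg (hK : IsCompact K) (hne : K.Nonempty) (h : HasSupportPointDeriv K u x A)
    (w : EuclideanSpace ℝ (Fin n)) : 0 ≤ inner ℝ (A w) w := by
  simpa using h.inner_sub_inner_add_nonneg hK hne 0 w

/-- The support points are the same along the ray through `u`, so `u` is in the kernel. -/
theorem apply_self (hK : IsCompact K) (hne : K.Nonempty) (h : HasSupportPointDeriv K u x A) :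
    A u = 0 := by
  have hx := h.isSupportPoint hK hne
  have hlim : Tendsto (fun s : ℝ => (1 + s) • u) (𝓝[>] 0) (𝓝 u) := by
    have : Tendsto (fun s : ℝ => (1 + s) • u) (𝓝 0) (𝓝 (((1 : ℝ) + 0) • u)) :=
      (Continuous.tendsto (by fun_prop) 0)
    rw [add_zero, one_smul] at this
    exact this.mono_left nhdsWithin_le_nhds
  have main : ∀ ε > 0, ‖A u‖ ≤ ε * ‖u‖ := by
    intro ε hε
    obtain ⟨s, h1, hs⟩ := ((hlim.eventually (h ε hε)).and self_mem_nhdsWithin).exists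
    have hs : 0 < s := hs
    have h1 := h1 x (hx.smul (by positivity))
    have e : (1 + s) • u - u = s • u := by module
    rw [e, sub_self, zero_sub, norm_neg, map_smul, norm_smul, norm_smul, Real.norm_eq_abs,
      abs_of_pos hs] at h1
    refine le_of_mul_le_mul_left ?_ hs
    linarith
  rw [← norm_le_zero_iff]
  refine le_of_forall_pos_le_add fun η hη => ?_
  have := main (η / (‖u‖ + 1)) (by positivity)
  have h7 : η / (‖u‖ + 1) * ‖u‖ ≤ η := by
    rw [div_mul_eq_mul_div, div_le_iff₀ (by positivity)]
    nlinarith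
  linarith

theorem hasGenHessianAt (hK : IsCompact K) (hne : K.Nonempty)
    (h : HasSupportPointDeriv K u x A) :
    HasGenHessianAt (supportFun K) (A : EuclideanSpace ℝ (Fin n) →ₗ[ℝ] _) u := by
  have hg := h.hasGradientAt hK hne
  refine ⟨hg.differentiableAt, h.isSymmetric hK hne, ?_⟩
  rw [hg.gradient]
  refine IsLittleO.of_bound fun ε hε => ?_
  filter_upwards [h.eventually_abs_sub_le hK hne hε] with y hy
  rw [Real.norm_eq_abs, Real.norm_eq_abs, abs_of_nonneg (sq_nonneg ‖y - u‖)]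
  exact hy

end HasSupportPointDeriv

/-- The second derivative in the generalized sense is unique. -/
theorem HasGenHessianAt.unique {f : EuclideanSpace ℝ (Fin n) → ℝ}
    {A B : EuclideanSpace ℝ (Fin n) →ₗ[ℝ] EuclideanSpace ℝ (Fin n)}
    {u : EuclideanSpace ℝ (Fin n)} (hA : HasGenHessianAt f A u) (hB : HasGenHessianAt f B u) :
    A = B := by
  rw [← sub_eq_zero, ← (hA.2.1.sub hB.2.1).inner_map_self_eq_zero]
  intro v
  have hd := hB.2.2.sub hA.2.2
  have hlim : Tendsto (fun s : ℝ => u + s • v) (𝓝[>] 0) (𝓝 u) := by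
    have : Tendsto (fun s : ℝ => u + s • v) (𝓝 0) (𝓝 (u + (0 : ℝ) • v)) :=
      (Continuous.tendsto (by fun_prop) 0)
    rw [zero_smul, add_zero] at this
    exact this.mono_left nhdsWithin_le_nhds
  have main : ∀ ε > 0, |inner ℝ ((A - B) v) v| ≤ ε * (2 * ‖v‖ ^ 2) := by
    intro ε hε
    obtain ⟨s, h1, hs⟩ := ((hlim.eventually (hd.bound hε)).and self_mem_nhdsWithin).exists
    have hs : 0 < s := hs
    have e : ∀ a b c d : ℝ, a - (b + c + 1 / 2 * d) - (a - (b + c + 1 / 2 * inner ℝ (A (s • v))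
        (s • v))) = 1 / 2 * (inner ℝ (A (s • v)) (s • v) - d) := by intros; ring
    simp only [add_sub_cancel_left, e] at h1
    rw [← inner_sub_left, ← LinearMap.sub_apply, map_smul, real_inner_smul_left,
      real_inner_smul_right, norm_smul, Real.norm_eq_abs, Real.norm_eq_abs, Real.norm_eq_abs,
      abs_of_pos hs, abs_of_nonneg (a := (s * ‖v‖) ^ 2) (by positivity), abs_mul, abs_mul, abs_mul,
      abs_of_pos hs, abs_of_pos (a := (1 / 2 : ℝ)) (by norm_num)] at h1
    have hs2 : 0 < s ^ 2 := by positivity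
    refine le_of_mul_le_mul_left ?_ hs2
    linarith
  rw [← abs_nonpos_iff]
  refine le_of_forall_pos_le_add fun η hη => ?_
  have := main (η / (2 * ‖v‖ ^ 2 + 1)) (by positivity)
  have h7 : η / (2 * ‖v‖ ^ 2 + 1) * (2 * ‖v‖ ^ 2) ≤ η := by
    rw [div_mul_eq_mul_div, div_le_iff₀ (by positivity)]
    nlinarith
  linarith

theorem HasGenHessianAt.genHessian_eq {f : EuclideanSpace ℝ (Fin n) → ℝ}
    {A : EuclideanSpace ℝ (Fin n) →ₗ[ℝ] EuclideanSpace ℝ (Fin n)}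
    {u : EuclideanSpace ℝ (Fin n)} (hA : HasGenHessianAt f A u) : genHessian f u = A := by
  have h : u ∈ secondOrderDiffSet f := ⟨A, hA⟩
  rw [genHessian, dif_pos h]
  exact h.choose_spec.unique hA

/-! ### Density points of Euclidean space -/

/-- The set `N` has Lebesgue density `0` at the point `w`. -/
def DensityZeroAt {m : ℕ} (N : Set (EuclideanSpace ℝ (Fin m))) (w : EuclideanSpace ℝ (Fin m)) :
    Prop :=
  ∀ ε : ENNReal, 0 < ε → ∀ᶠ r : ℝ in 𝓝[>] 0, volume (N ∩ ball w r) ≤ ε * volume (ball w r)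

/-- A `C`-Lipschitz map increases the `d`-dimensional measure at most by the factor `C ^ d`. -/
theorem euclideanHausdorffMeasure_image_le {X Y : Type*} [MetricSpace X] [MeasurableSpace X]
    [BorelSpace X] [MetricSpace Y] [MeasurableSpace Y] [BorelSpace Y] {d : ℕ} {C : NNReal}
    {f : X → Y} {s : Set X} (hf : LipschitzOnWith C f s) :
    μHE[d] (f '' s) ≤ (C : ENNReal) ^ d * μHE[d] s := by
  have h := hf.hausdorffMeasure_image_le (Nat.cast_nonneg (α := ℝ) d)
  rw [ENNReal.rpow_natCast] at h
  rw [Measure.euclideanHausdorffMeasure_def, Measure.euclideanHausdorffMeasure_def,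
    Measure.smul_apply, Measure.smul_apply, mul_smul_comm]
  gcongr

section Density

theorem tendsto_const_mul_nhdsGT_zero {c : ℝ} (hc : 0 < c) :
    Tendsto (fun r : ℝ => c * r) (𝓝[>] 0) (𝓝[>] 0) := by
  refine tendsto_nhdsWithin_iff.2 ⟨?_, ?_⟩
  · have : Tendsto (fun r : ℝ => c * r) (𝓝 0) (𝓝 (c * 0)) :=
      Continuous.tendsto (by fun_prop) 0
    rw [mul_zero] at this
    exact this.mono_left nhdsWithin_le_nhds
  · filter_upwards [self_mem_nhdsWithin] with r hr
    exact mul_pos hc hr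

variable {m : ℕ} {N M : Set (EuclideanSpace ℝ (Fin m))} {w : EuclideanSpace ℝ (Fin m)}

theorem volume_ball_eq (z : EuclideanSpace ℝ (Fin m)) {r : ℝ} (hr : 0 < r) :
    volume (ball z r) =
      ENNReal.ofReal (r ^ m) * volume (ball (0 : EuclideanSpace ℝ (Fin m)) 1) := by
  rw [Measure.addHaar_ball_of_pos _ _ hr, finrank_euclideanSpace_fin]

theorem DensityZeroAt.union (hN : DensityZeroAt N w) (hM : DensityZeroAt M w) :
    DensityZeroAt (N ∪ M) w := by
  intro ε hε
  filter_upwards [hN (ε / 2) (ENNReal.half_pos hε.ne'), hM (ε / 2) (ENNReal.half_pos hε.ne')]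
    with r h1 h2
  rw [Set.union_inter_distrib_right]
  refine (measure_union_le _ _).trans ((add_le_add h1 h2).trans ?_)
  rw [← add_mul, ENNReal.add_halves]

/-- **Lebesgue density theorem**, in the form used here. -/
theorem ae_densityZeroAt_compl {B : Set (EuclideanSpace ℝ (Fin m))} (hB : MeasurableSet B) :
    ∀ᵐ w, w ∈ B → DensityZeroAt Bᶜ w := by
  filter_upwards [Besicovitch.ae_tendsto_measure_inter_div_of_measurableSet volume hB.compl]
    with w hw hwB ε hε
  rw [Set.indicator_of_notMem (by simpa using hwB)] at hw
  filter_upwards [hw.eventually (ge_mem_nhds hε), self_mem_nhdsWithin] with r hr hr0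
  have hr0 : 0 < r := hr0
  have hcl : volume (closedBall w r) = volume (ball w r) := by
    rw [Measure.addHaar_closedBall _ _ hr0.le, Measure.addHaar_ball_of_pos _ _ hr0]
  rw [hcl, ENNReal.div_le_iff (measure_ball_pos _ _ hr0).ne' measure_ball_lt_top.ne] at hr
  exact (measure_mono (Set.inter_subset_inter_right _ ball_subset_closedBall)).trans hr

/-- The complement of a set of density `0` at `w` is asymptotically dense near `w`: a ball whose
radius is proportional to its distance from `w` has a fixed proportion of the volume. -/
theorem DensityZeroAt.eventually_exists_notMem (hN : DensityZeroAt N w) {ε : ℝ} (hε : 0 < ε) :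
    ∀ᶠ r : ℝ in 𝓝[>] 0, ∀ z ∈ closedBall w r, ∃ z' ∉ N, dist z' z ≤ ε * r := by
  have hlim := tendsto_const_mul_nhdsGT_zero (c := (1 + ε)) (by positivity)
  set c : ℝ := (ε / (1 + ε)) ^ m / 2 with hc
  have hc0 : 0 < c := by positivity
  filter_upwards [hlim.eventually (hN (ENNReal.ofReal c) (ENNReal.ofReal_pos.2 hc0)),
    self_mem_nhdsWithin] with r hr hr0 z hz
  have hr0 : 0 < r := hr0
  by_contra! hcon
  have hsub : ball z (ε * r) ⊆ N ∩ ball w ((1 + ε) * r) := by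
    intro z' hz'
    refine ⟨by_contra fun h => (hcon z' h).not_gt hz', ?_⟩
    rw [mem_ball] at *
    calc dist z' w ≤ dist z' z + dist z w := dist_triangle _ _ _
      _ < ε * r + r := add_lt_add_of_lt_of_le hz' hz
      _ = _ := by ring
  have h1 := (measure_mono (μ := volume) hsub).trans hr
  rw [volume_ball_eq z (by positivity), volume_ball_eq w (by positivity), ← mul_assoc,
    ENNReal.mul_le_mul_iff_left (measure_ball_pos _ _ one_pos).ne' measure_ball_lt_top.ne,
    ← ENNReal.ofReal_mul hc0.le, ENNReal.ofReal_le_ofReal_iff (by positivity)] at h1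
  have h2 : c * ((1 + ε) * r) ^ m = (ε * r) ^ m / 2 := by
    rw [hc, div_pow, mul_pow, mul_pow]
    field_simp
  rw [h2] at h1
  have : 0 < (ε * r) ^ m := by positivity
  linarith

end Density

/-! ### Central projection charts of the sphere -/

section Chart

/-- `e` is a unit vector and `J` is an isometric parametrization of the hyperplane `e^⊥`. -/
structure IsTangentFrame (J : EuclideanSpace ℝ (Fin (n - 1)) →ₗᵢ[ℝ] EuclideanSpace ℝ (Fin n))
    (e : EuclideanSpace ℝ (Fin n)) : Prop where
  norm_eq_one : ‖e‖ = 1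
  exists_eq_iff : ∀ y, (∃ w, J w = y) ↔ inner ℝ e y = 0

theorem exists_isTangentFrame {e : EuclideanSpace ℝ (Fin n)} (he : ‖e‖ = 1) :
    ∃ J : EuclideanSpace ℝ (Fin (n - 1)) →ₗᵢ[ℝ] EuclideanSpace ℝ (Fin n), IsTangentFrame J e := by
  have he0 : e ≠ 0 := by
    rintro rfl
    simp at he
  have hfin : Module.finrank ℝ (ℝ ∙ e)ᗮ = n - 1 := by
    have h := Submodule.finrank_add_finrank_orthogonal (ℝ ∙ e)
    rw [finrank_span_singleton he0, finrank_euclideanSpace_fin] at h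
    omega
  let b := (stdOrthonormalBasis ℝ (ℝ ∙ e)ᗮ).reindex (finCongr hfin)
  refine ⟨(ℝ ∙ e)ᗮ.subtypeₗᵢ.comp b.repr.symm.toLinearIsometry, he, fun y => ?_⟩
  rw [← Submodule.mem_orthogonal_singleton_iff_inner_right]
  constructor
  · rintro ⟨w, rfl⟩
    exact (b.repr.symm w).2
  · intro hy
    exact ⟨b.repr ⟨y, hy⟩, by simp⟩

variable (J : EuclideanSpace ℝ (Fin (n - 1)) →ₗᵢ[ℝ] EuclideanSpace ℝ (Fin n))
  (e : EuclideanSpace ℝ (Fin n))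

/-- Central projection of the tangent hyperplane `e + e^⊥` to the unit sphere, where `e^⊥` is
parametrized by `J`. -/
noncomputable def centralProj (w : EuclideanSpace ℝ (Fin (n - 1))) : EuclideanSpace ℝ (Fin n) :=
  ‖J w + e‖⁻¹ • (J w + e)

/-- The inverse of `centralProj` on the open half space `⟨e, y⟩ > 0`, constant along rays. -/
noncomputable def centralCoord (y : EuclideanSpace ℝ (Fin n)) : EuclideanSpace ℝ (Fin (n - 1)) :=
  (inner ℝ e y)⁻¹ • ContinuousLinearMap.adjoint J.toContinuousLinearMap y

/-- Normalization does not increase distances outside the open unit ball. -/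
theorem norm_normalize_sub_normalize_le {a b : EuclideanSpace ℝ (Fin n)} (ha : 1 ≤ ‖a‖)
    (hb : 1 ≤ ‖b‖) : ‖‖a‖⁻¹ • a - ‖b‖⁻¹ • b‖ ≤ ‖a - b‖ := by
  have ha0 : 0 < ‖a‖ := by linarith
  have hb0 : 0 < ‖b‖ := by linarith
  rw [← sq_le_sq₀ (norm_nonneg _) (norm_nonneg _), norm_sub_sq_real, norm_sub_sq_real,
    norm_smul, norm_smul, real_inner_smul_left, real_inner_smul_right, norm_inv, norm_norm,
    norm_inv, norm_norm, inv_mul_cancel₀ ha0.ne', inv_mul_cancel₀ hb0.ne']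
  set c := ‖a‖⁻¹ * (‖b‖⁻¹ * inner ℝ a b) with hc
  have hin : inner ℝ a b = ‖a‖ * ‖b‖ * c := by
    rw [hc]
    field_simp
  have hc1 : c ≤ 1 := by
    have := real_inner_le_norm a b
    rw [hin] at this
    by_contra! hlt
    nlinarith [mul_pos ha0 hb0]
  rw [hin]
  nlinarith [mul_nonneg (sub_nonneg.2 ha) (sub_nonneg.2 hb), sq_nonneg (‖a‖ - ‖b‖),
    mul_nonneg (sub_nonneg.2 hc1) (sub_nonneg.2 (one_le_mul_of_one_le_of_one_le ha hb))]

namespace IsTangentFrame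

variable {J e}

theorem inner_apply (h : IsTangentFrame J e) (w : EuclideanSpace ℝ (Fin (n - 1))) :
    inner ℝ e (J w) = 0 :=
  (h.exists_eq_iff _).1 ⟨w, rfl⟩

theorem inner_apply_add (h : IsTangentFrame J e) (w : EuclideanSpace ℝ (Fin (n - 1))) :
    inner ℝ e (J w + e) = 1 := by
  rw [inner_add_right, h.inner_apply, real_inner_self_eq_norm_sq, h.norm_eq_one]
  norm_num

theorem one_le_norm (h : IsTangentFrame J e) (w : EuclideanSpace ℝ (Fin (n - 1))) :
    1 ≤ ‖J w + e‖ := by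
  have := real_inner_le_norm e (J w + e)
  rwa [h.inner_apply_add, h.norm_eq_one, one_mul] at this

theorem adjoint_self (h : IsTangentFrame J e) :
    ContinuousLinearMap.adjoint J.toContinuousLinearMap e = 0 := by
  refine ext_inner_right ℝ fun w => ?_
  rw [ContinuousLinearMap.adjoint_inner_left, inner_zero_left]
  exact h.inner_apply w

theorem adjoint_apply (w : EuclideanSpace ℝ (Fin (n - 1))) :
    ContinuousLinearMap.adjoint J.toContinuousLinearMap (J w) = w := by
  refine ext_inner_right ℝ fun z => ?_
  rw [ContinuousLinearMap.adjoint_inner_left]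
  exact J.inner_map_map w z

theorem apply_adjoint (h : IsTangentFrame J e) (y : EuclideanSpace ℝ (Fin n)) :
    J (ContinuousLinearMap.adjoint J.toContinuousLinearMap y) = y - inner ℝ e y • e := by
  obtain ⟨w, hw⟩ := (h.exists_eq_iff (y - inner ℝ e y • e)).2 (by
    rw [inner_sub_right, real_inner_smul_right, real_inner_self_eq_norm_sq, h.norm_eq_one]
    ring)
  have hy : y = J w + inner ℝ e y • e := by
    rw [hw]
    abel
  conv_lhs => rw [hy]
  rw [map_add, map_smul, h.adjoint_self, smul_zero, add_zero, adjoint_apply, hw]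

theorem centralCoord_centralProj (h : IsTangentFrame J e) (w : EuclideanSpace ℝ (Fin (n - 1))) :
    centralCoord J e (centralProj J e w) = w := by
  have h0 := (one_pos.trans_le (h.one_le_norm w)).ne'
  rw [centralCoord, centralProj, real_inner_smul_right, h.inner_apply_add, mul_one, inv_inv,
    map_smul, map_add, h.adjoint_self, add_zero, adjoint_apply, smul_smul, mul_inv_cancel₀ h0,
    one_smul]

theorem inner_centralProj_pos (h : IsTangentFrame J e) (w : EuclideanSpace ℝ (Fin (n - 1))) :
    0 < inner ℝ e (centralProj J e w) := by
  rw [centralProj, real_inner_smul_right, h.inner_apply_add, mul_one]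
  exact inv_pos.2 (one_pos.trans_le (h.one_le_norm w))

theorem centralProj_centralCoord (h : IsTangentFrame J e) {y : EuclideanSpace ℝ (Fin n)}
    (hy : 0 < inner ℝ e y) : centralProj J e (centralCoord J e y) = ‖y‖⁻¹ • y := by
  have e1 : J (centralCoord J e y) + e = (inner ℝ e y)⁻¹ • y := by
    rw [centralCoord, map_smul, h.apply_adjoint, smul_sub, smul_smul, inv_mul_cancel₀ hy.ne',
      one_smul, sub_add_cancel]
  rw [centralProj, e1, norm_smul, norm_inv, Real.norm_eq_abs, abs_of_pos hy, smul_smul, mul_inv,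
    inv_inv, mul_right_comm, mul_inv_cancel₀ hy.ne', one_mul]

theorem lipschitzWith_centralProj (h : IsTangentFrame J e) :
    LipschitzWith 1 (centralProj J e) := by
  refine LipschitzWith.of_dist_le_mul fun w z => ?_
  rw [NNReal.coe_one, one_mul, dist_eq_norm, dist_eq_norm]
  refine (norm_normalize_sub_normalize_le (h.one_le_norm w) (h.one_le_norm z)).trans_eq ?_
  rw [add_sub_add_right_eq_sub, ← map_sub, J.norm_map]

theorem contDiffAt_centralCoord {y : EuclideanSpace ℝ (Fin n)} (hy : 0 < inner ℝ e y) :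
    ContDiffAt ℝ 1 (centralCoord J e) y := by
  refine ContDiffAt.smul (ContDiffAt.inv ?_ hy.ne') ?_
  · exact contDiffAt_const.inner ℝ contDiffAt_id
  · exact (ContinuousLinearMap.contDiff _).contDiffAt

/-- Density zero with respect to the Hausdorff measure on the sphere passes to the chart, because
the inverse of the chart is locally Lipschitz. -/
theorem densityZeroAt_preimage (h : IsTangentFrame J e) {A S : Set (EuclideanSpace ℝ (Fin n))}
    (hA : MeasurableSet A) {w : EuclideanSpace ℝ (Fin (n - 1))}
    (hS : HasDensity ((μHE[n - 1].restrict A).restrict Sᶜ) (n - 1) (centralProj J e w) 0) :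
    DensityZeroAt (centralProj J e ⁻¹' (A \ S)) w := by
  set u := centralProj J e w with hu
  obtain ⟨L, t, ht, hL⟩ :=
    (contDiffAt_centralCoord (J := J) (h.inner_centralProj_pos w)).exists_lipschitzOnWith
  obtain ⟨ρ, hρ, hball⟩ := Metric.mem_nhds_iff.1 ht
  have hc : volume (ball (0 : EuclideanSpace ℝ (Fin (n - 1))) 1) ≠ 0 :=
    (measure_ball_pos _ _ one_pos).ne'
  have hc' : volume (ball (0 : EuclideanSpace ℝ (Fin (n - 1))) 1) ≠ ⊤ := measure_ball_lt_top.ne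
  intro ε hε
  have hη : 0 < ε / ((L : ENNReal) ^ (n - 1)) :=
    ENNReal.div_pos hε.ne' (ENNReal.pow_ne_top ENNReal.coe_ne_top)
  have hη' : (L : ENNReal) ^ (n - 1) * (ε / (L : ENNReal) ^ (n - 1)) ≤ ε := ENNReal.mul_div_le
  filter_upwards [hS.eventually (ge_mem_nhds hη), Ioo_mem_nhdsGT hρ] with r hr hr0
  have hr1 : 0 < ENNReal.ofReal (r ^ (n - 1)) := ENNReal.ofReal_pos.2 (pow_pos hr0.1 _)
  rw [ENNReal.div_le_iff (mul_ne_zero hc hr1.ne') (ENNReal.mul_ne_top hc' ENNReal.ofReal_ne_top),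
    Measure.restrict_apply measurableSet_ball, Measure.restrict_apply' hA] at hr
  have hsub : centralProj J e ⁻¹' (A \ S) ∩ ball w r ⊆
      centralCoord J e '' (ball u r ∩ Sᶜ ∩ A) := by
    rintro z ⟨⟨hzA, hzS⟩, hz⟩
    refine ⟨centralProj J e z, ⟨⟨?_, hzS⟩, hzA⟩, h.centralCoord_centralProj z⟩
    rw [mem_ball] at *
    refine (h.lipschitzWith_centralProj.dist_le_mul z w).trans_lt ?_
    rwa [NNReal.coe_one, one_mul]
  have hLip : LipschitzOnWith L (centralCoord J e) (ball u r ∩ Sᶜ ∩ A) :=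
    hL.mono fun z hz => hball (ball_subset_ball hr0.2.le hz.1.1)
  calc volume (centralProj J e ⁻¹' (A \ S) ∩ ball w r)
      ≤ volume (centralCoord J e '' (ball u r ∩ Sᶜ ∩ A)) := measure_mono hsub
    _ ≤ (L : ENNReal) ^ (n - 1) * μHE[n - 1] (ball u r ∩ Sᶜ ∩ A) := by
        rw [← EuclideanSpace.euclideanHausdorffMeasure_eq_volume]
        exact euclideanHausdorffMeasure_image_le hLip
    _ ≤ (L : ENNReal) ^ (n - 1) * (ε / (L : ENNReal) ^ (n - 1) *
          (volume (ball (0 : EuclideanSpace ℝ (Fin (n - 1))) 1) * ENNReal.ofReal (r ^ (n - 1)))) := by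
        gcongr
    _ ≤ ε * volume (ball w r) := by
        rw [← mul_assoc, volume_ball_eq w hr0.1, mul_comm (volume _)]
        gcongr

end IsTangentFrame

/-- A set `S` is asymptotically dense in the unit sphere at `u`: within distance `r` of `u`, the
central projection of every point to the sphere is `o(r)`-close to `S`, uniformly. -/
def SphereDenseAt (S : Set (EuclideanSpace ℝ (Fin n))) (u : EuclideanSpace ℝ (Fin n)) : Prop :=
  ∀ ε > 0, ∀ᶠ r : ℝ in 𝓝[>] 0, ∀ y ∈ closedBall u r, ∃ z ∈ S, ‖z - ‖y‖⁻¹ • y‖ ≤ ε * r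

theorem IsTangentFrame.sphereDenseAt {J : EuclideanSpace ℝ (Fin (n - 1)) →ₗᵢ[ℝ]
    EuclideanSpace ℝ (Fin n)} {e : EuclideanSpace ℝ (Fin n)} (h : IsTangentFrame J e)
    {S : Set (EuclideanSpace ℝ (Fin n))} {w : EuclideanSpace ℝ (Fin (n - 1))}
    (hS : DensityZeroAt (centralProj J e ⁻¹' S)ᶜ w) :
    SphereDenseAt S (centralProj J e w) := by
  set u := centralProj J e w with hu
  have hpos := h.inner_centralProj_pos w
  obtain ⟨L₀, t, ht, hL₀⟩ :=
    (IsTangentFrame.contDiffAt_centralCoord (J := J) hpos).exists_lipschitzOnWith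
  obtain ⟨L, hL0, hL⟩ : ∃ L : NNReal, 0 < L ∧ LipschitzOnWith L (centralCoord J e) t :=
    ⟨L₀ + 1, by positivity, hL₀.weaken (by simp)⟩
  have hL0' : (0 : ℝ) < L := hL0
  have hhalf : {y : EuclideanSpace ℝ (Fin n) | 0 < inner ℝ e y} ∈ 𝓝 u :=
    (isOpen_lt continuous_const (by fun_prop)).mem_nhds hpos
  obtain ⟨ρ, hρ, hball⟩ := Metric.mem_nhds_iff.1 (inter_mem ht hhalf)
  intro ε hε
  have hlim := tendsto_const_mul_nhdsGT_zero (c := L) (by positivity)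
  filter_upwards [hlim.eventually (hS.eventually_exists_notMem (ε := ε / L) (by positivity)),
    Ioo_mem_nhdsGT hρ] with r hr hr0 y hy
  have hyt := hball (closedBall_subset_ball hr0.2 hy)
  have hz : centralCoord J e y ∈ closedBall w (L * r) := by
    have := hL.dist_le_mul y hyt.1 u (mem_of_mem_nhds ht)
    rw [hu, h.centralCoord_centralProj] at this
    exact this.trans (mul_le_mul_of_nonneg_left hy hL0'.le)
  obtain ⟨z', hz', hd⟩ := hr _ hz
  refine ⟨centralProj J e z', not_not.1 hz', ?_⟩
  rw [← h.centralProj_centralCoord hyt.2, ← dist_eq_norm]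
  refine (h.lipschitzWith_centralProj.dist_le_mul _ _).trans ?_
  rw [NNReal.coe_one, one_mul]
  refine hd.trans_eq ?_
  field_simp

/-- The properties of a point `u` of a set `A` in the sphere, for a map `f` on `A`, that hold
almost everywhere by the theorems of Rademacher and Lebesgue. -/
def IsRegularPoint (A : Set (EuclideanSpace ℝ (Fin n)))
    (f : EuclideanSpace ℝ (Fin n) → EuclideanSpace ℝ (Fin n)) (u : EuclideanSpace ℝ (Fin n)) :
    Prop :=
  DifferentiableWithinAt ℝ f A u ∧ ∀ S : Set (EuclideanSpace ℝ (Fin n)),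
    HasDensity ((μHE[n - 1].restrict A).restrict Sᶜ) (n - 1) u 0 → SphereDenseAt (A ∩ S) u

theorem IsTangentFrame.ae_isRegularPoint {J : EuclideanSpace ℝ (Fin (n - 1)) →ₗᵢ[ℝ]
    EuclideanSpace ℝ (Fin n)} {e : EuclideanSpace ℝ (Fin n)} (h : IsTangentFrame J e)
    {A : Set (EuclideanSpace ℝ (Fin n))} (hA : MeasurableSet A) (hA1 : A ⊆ sphere 0 1)
    {f : EuclideanSpace ℝ (Fin n) → EuclideanSpace ℝ (Fin n)} {C : NNReal}
    (hf : LipschitzOnWith C f A) :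
    ∀ᵐ u ∂(μHE[n - 1] : Measure (EuclideanSpace ℝ (Fin n))),
      u ∈ A → 0 < inner ℝ e u → IsRegularPoint A f u := by
  set B := centralProj J e ⁻¹' A with hB
  have hφ := h.lipschitzWith_centralProj
  have hBm : MeasurableSet B := hφ.continuous.measurable hA
  have hfB : LipschitzOnWith (C * 1) (f ∘ centralProj J e) B :=
    hf.comp hφ.lipschitzOnWith fun _ hz => hz
  have hae := (hfB.ae_differentiableWithinAt_of_mem (μ := volume)).and (ae_densityZeroAt_compl hBm)
  rw [ae_iff] at hae ⊢
  have hinv : ∀ {y}, y ∈ A → 0 < inner ℝ e y → centralProj J e (centralCoord J e y) = y := by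
    intro y hy hy0
    have : ‖y‖ = 1 := by simpa using hA1 hy
    rw [h.centralProj_centralCoord hy0, this, inv_one, one_smul]
  refine le_antisymm ?_ zero_le
  refine (measure_mono (t := centralProj J e '' {w | ¬((w ∈ B → DifferentiableWithinAt ℝ
    (f ∘ centralProj J e) B w) ∧ (w ∈ B → DensityZeroAt Bᶜ w))}) ?_).trans
    ((euclideanHausdorffMeasure_image_le hφ.lipschitzOnWith).trans ?_)
  · intro u hu
    by_contra hcon
    refine hu fun huA hu0 => ?_
    set w := centralCoord J e u with hw
    have hwu : centralProj J e w = u := hinv huA hu0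
    have hwB : w ∈ B := by
      change centralProj J e w ∈ A
      rwa [hwu]
    have hgood : (w ∈ B → DifferentiableWithinAt ℝ (f ∘ centralProj J e) B w) ∧
        (w ∈ B → DensityZeroAt Bᶜ w) := by
      by_contra hbad
      exact hcon ⟨w, hbad, hwu⟩
    refine ⟨?_, fun S hS => ?_⟩
    · have hhalf : {y : EuclideanSpace ℝ (Fin n) | 0 < inner ℝ e y} ∈ 𝓝 u :=
        (isOpen_lt continuous_const (by fun_prop)).mem_nhds hu0
      rw [← differentiableWithinAt_inter hhalf]
      have hcomp : DifferentiableWithinAt ℝ ((f ∘ centralProj J e) ∘ centralCoord J e)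
          (A ∩ {y : EuclideanSpace ℝ (Fin n) | 0 < inner ℝ e y}) u := by
        refine DifferentiableWithinAt.comp (t := B) u (hgood.1 hwB) ?_ ?_
        · exact ((IsTangentFrame.contDiffAt_centralCoord hu0).differentiableAt
            one_ne_zero).differentiableWithinAt
        · rintro y ⟨hy, hy0⟩
          change centralProj J e (centralCoord J e y) ∈ A
          rwa [hinv hy hy0]
      refine hcomp.congr (fun y hy => ?_) ?_
      · simp only [Function.comp_apply, hinv hy.1 hy.2]
      · simp only [Function.comp_apply, hinv huA hu0]
    · rw [← hwu] at hS ⊢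
      refine h.sphereDenseAt ?_
      have := (hgood.2 hwB).union (h.densityZeroAt_preimage hA hS)
      convert this using 1
      ext z
      simp only [hB, Set.mem_compl_iff, Set.mem_preimage, Set.mem_inter_iff, Set.mem_union,
        Set.mem_sdiff]
      tauto
  · rw [EuclideanSpace.euclideanHausdorffMeasure_eq_volume, hae, mul_zero]

/-- Almost every point of a set in the sphere is regular for a given Lipschitz map. -/
theorem ae_isRegularPoint {A : Set (EuclideanSpace ℝ (Fin n))} (hA : MeasurableSet A)
    (hA1 : A ⊆ sphere 0 1) {f : EuclideanSpace ℝ (Fin n) → EuclideanSpace ℝ (Fin n)} {C : NNReal}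
    (hf : LipschitzOnWith C f A) :
    ∀ᵐ u ∂(μHE[n - 1] : Measure (EuclideanSpace ℝ (Fin n))), u ∈ A → IsRegularPoint A f u := by
  -- the open hemispheres around the vectors `± e_j` cover the sphere
  have hcover : ∀ e : EuclideanSpace ℝ (Fin n), ‖e‖ = 1 →
      ∀ᵐ u ∂(μHE[n - 1] : Measure (EuclideanSpace ℝ (Fin n))),
        u ∈ A → 0 < inner ℝ e u → IsRegularPoint A f u := by
    intro e he
    obtain ⟨J, hJ⟩ := exists_isTangentFrame he
    exact hJ.ae_isRegularPoint hA hA1 hf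
  have hpos := ae_all_iff.2 fun j : Fin n =>
    hcover (EuclideanSpace.single j 1) (by simp)
  have hneg := ae_all_iff.2 fun j : Fin n =>
    hcover (EuclideanSpace.single j (-1)) (by simp)
  filter_upwards [hpos, hneg] with u h1 h2 hu
  have hu0 : u ≠ 0 := by
    rintro rfl
    simpa using hA1 hu
  obtain ⟨j, hj⟩ : ∃ j, u j ≠ 0 := by
    by_contra! hall
    exact hu0 (by ext j; simpa using hall j)
  rcases lt_or_gt_of_ne hj with hj | hj
  · exact h2 j hu (by simpa [EuclideanSpace.inner_single_left] using hj)
  · exact h1 j hu (by simpa [EuclideanSpace.inner_single_left] using hj)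

end Chart

/-! ### The norm of the top exterior power -/

section ExteriorPower

variable {V W : Type*} [NormedAddCommGroup V] [InnerProductSpace ℝ V] [FiniteDimensional ℝ V]
  [NormedAddCommGroup W] [InnerProductSpace ℝ W] [FiniteDimensional ℝ W]

/-- On the top exterior power, a line, the operator norm is the length of the image of the volume
element, hence the square root of a Gram determinant. -/
theorem exteriorPowerNorm_eq_normDet {m : ℕ} (hV : Module.finrank ℝ V = m) (f : V →ₗ[ℝ] W) :
    exteriorPowerNorm m f = f.normDet := by
  let b : OrthonormalBasis (Fin m) ℝ V := (stdOrthonormalBasis ℝ V).reindex (finCongr hV)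
  set ω := exteriorPower.ιMulti ℝ m b with hω
  have hω1 : ‖ω‖ = 1 := by
    rw [← sq_eq_sq₀ (norm_nonneg _) zero_le_one, ← real_inner_self_eq_norm_sq,
      exteriorPower.inner_ιMulti_self, Matrix.gram_eq_one_iff_orthonormal.2 b.orthonormal,
      Matrix.det_one, one_pow]
  have hω0 : ω ≠ 0 := by
    intro h0
    rw [h0, norm_zero] at hω1
    exact zero_ne_one hω1
  have hspan : ∀ z : ⋀[ℝ]^m V, ∃ c : ℝ, c • ω = z :=
    (finrank_eq_one_iff_of_nonzero' ω hω0).1 (by rw [exteriorPower.finrank_eq, hV, Nat.choose_self])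
  have himg : ‖exteriorPower.map m f ω‖ = f.normDet := by
    rw [← sq_eq_sq₀ (norm_nonneg _) f.normDet_nonneg, ← real_inner_self_eq_norm_sq, hω,
      exteriorPower.map_apply_ιMulti, exteriorPower.inner_ιMulti_self]
    exact (f.normDet_sq_eq_det_gram b).symm
  rw [exteriorPowerNorm]
  refine ContinuousLinearMap.opNorm_eq_of_bounds f.normDet_nonneg (fun z => ?_) fun c hc h => ?_
  · obtain ⟨c, rfl⟩ := hspan z
    rw [LinearMap.coe_toContinuousLinearMap', map_smul, norm_smul, norm_smul, himg, hω1]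
    linarith
  · have := h ω
    rwa [LinearMap.coe_toContinuousLinearMap', himg, hω1, mul_one] at this

theorem det_nonneg_of_isPositive {f : V →ₗ[ℝ] V} (hf : f.IsPositive) : 0 ≤ LinearMap.det f := by
  rw [hf.isSymmetric.det_eq_prod_eigenvalues rfl]
  exact Finset.prod_nonneg fun i _ => by
    simpa using hf.nonneg_eigenvalues rfl i

/-- A map that agrees with a positive operator on an invariant subspace `V'` of dimension `m` has
the determinant of the restricted operator as the norm of its `m`-th exterior power. The equation
`V = V'` is a hypothesis because the domain of the map is only propositionally equal to `V'`. -/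
theorem exteriorPowerNorm_eq_det {m : ℕ} {V V' : Submodule ℝ W} (hVV' : V = V')
    (hfin : Module.finrank ℝ V' = m) {D : V →ₗ[ℝ] W} {ζ : W →ₗ[ℝ] W} (hD : ∀ v : V, D v = ζ v)
    (hpos : ζ.IsPositive) (hinv : ∀ v ∈ V', ζ v ∈ V') :
    exteriorPowerNorm m D = LinearMap.det (ζ.restrict hinv) := by
  subst hVV'
  have hmem : ∀ v, D v ∈ V := fun v => by
    rw [hD]
    exact hinv v v.2
  have hcod : D.codRestrict V hmem = ζ.restrict hinv := by
    ext1 v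
    exact Subtype.ext (hD v)
  rw [exteriorPowerNorm_eq_normDet hfin, ← LinearMap.normDet_codRestrict hmem, hcod,
    LinearMap.normDet_eq_abs_det, abs_of_nonneg]
  exact det_nonneg_of_isPositive ⟨fun v w => hpos.1 v w, fun v => hpos.2 v⟩

end ExteriorPower

/-! ### Approximate tangent cones and differentials -/

variable {A : Set (EuclideanSpace ℝ (Fin n))} {u : EuclideanSpace ℝ (Fin n)}
  {f : EuclideanSpace ℝ (Fin n) → EuclideanSpace ℝ (Fin n)}

theorem hasDensity_zero_of_eventually {η : Measure (EuclideanSpace ℝ (Fin n))} {m : ℕ}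
    (h : ∀ᶠ r : ℝ in 𝓝[>] 0, η (ball u r) = 0) : HasDensity η m u 0 := by
  refine tendsto_const_nhds.congr' ?_
  filter_upwards [h] with r hr
  rw [hr, ENNReal.zero_div]

/-- The tangent cone of a subset of the unit sphere is contained in the tangent hyperplane. -/
theorem inner_eq_zero_of_mem_tangentCone (hA : A ⊆ sphere 0 1) (hu : ‖u‖ = 1)
    {v : EuclideanSpace ℝ (Fin n)} (hv : v ∈ tangentCone A u) : inner ℝ u v = 0 := by
  rw [← abs_nonpos_iff]
  have main : ∀ ε > 0, |inner ℝ u v| ≤ ε * (1 + (‖v‖ + ε)) := by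
    intro ε hε
    obtain ⟨x, hx, r, hr, hxu, hxv⟩ := hv ε hε
    have hx1 : ‖x‖ = 1 := by simpa using hA hx
    have h1 : inner ℝ u (x - u) = -(‖x - u‖ ^ 2 / 2) := by
      rw [norm_sub_sq_real, inner_sub_right, real_inner_self_eq_norm_sq, hu, hx1,
        real_inner_comm x u]
      ring
    have h2 : inner ℝ u v = r * inner ℝ u (x - u) - inner ℝ u (r • (x - u) - v) := by
      rw [inner_sub_right u (r • (x - u)) v, real_inner_smul_right]
      ring
    have h3 : |inner ℝ u (r • (x - u) - v)| ≤ ε := by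
      refine (abs_real_inner_le_norm _ _).trans ?_
      rw [hu, one_mul]
      exact hxv.le
    have h4 : r * ‖x - u‖ ≤ ‖v‖ + ε := by
      have h5 := norm_sub_norm_le (r • (x - u)) v
      rw [norm_smul, Real.norm_eq_abs, abs_of_pos hr] at h5
      linarith
    have h5 : |r * inner ℝ u (x - u)| ≤ (‖v‖ + ε) * ε := by
      rw [h1, abs_mul, abs_of_pos hr, abs_neg, abs_of_nonneg (by positivity)]
      have h6 : r * ‖x - u‖ * ‖x - u‖ ≤ (‖v‖ + ε) * ε := by gcongr
      have h7 : 0 ≤ r * ‖x - u‖ * ‖x - u‖ := by positivity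
      linarith
    rw [h2]
    refine (abs_sub _ _).trans ?_
    linarith
  have hlim : Tendsto (fun ε : ℝ => ε * (1 + (‖v‖ + ε))) (𝓝[>] 0) (𝓝 0) := by
    have : Tendsto (fun ε : ℝ => ε * (1 + (‖v‖ + ε))) (𝓝 0) (𝓝 (0 * (1 + (‖v‖ + 0)))) :=
      Continuous.tendsto (by fun_prop) 0
    rw [zero_mul] at this
    exact this.mono_left nhdsWithin_le_nhds
  exact ge_of_tendsto hlim (by filter_upwards [self_mem_nhdsWithin] with ε hε using main ε hε)

/-- A set that is asymptotically dense in the sphere has the full tangent hyperplane as its tangent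
cone: the points `u + t v` are followed along the sphere. -/
theorem SphereDenseAt.mem_tangentCone {S : Set (EuclideanSpace ℝ (Fin n))}
    (hS : SphereDenseAt S u) (hu : ‖u‖ = 1) {v : EuclideanSpace ℝ (Fin n)}
    (hv : inner ℝ u v = 0) : v ∈ tangentCone S u := by
  intro ε hε
  set c : ℝ := ‖v‖ + 1 with hc
  have hc0 : 0 < c := by positivity
  have hlim := tendsto_const_mul_nhdsGT_zero (c := c) (by positivity)
  have hsmall1 : ∀ᶠ t : ℝ in 𝓝[>] 0, t * ‖v‖ ^ 2 < ε / 2 := by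
    have : Tendsto (fun t : ℝ => t * ‖v‖ ^ 2) (𝓝 0) (𝓝 (0 * ‖v‖ ^ 2)) :=
      Continuous.tendsto (by fun_prop) 0
    rw [zero_mul] at this
    exact (this.mono_left nhdsWithin_le_nhds).eventually (gt_mem_nhds (by positivity))
  have hsmall2 : ∀ᶠ t : ℝ in 𝓝[>] 0, t * (‖v‖ + ε) < ε := by
    have : Tendsto (fun t : ℝ => t * (‖v‖ + ε)) (𝓝 0) (𝓝 (0 * (‖v‖ + ε))) :=
      Continuous.tendsto (by fun_prop) 0
    rw [zero_mul] at this
    exact (this.mono_left nhdsWithin_le_nhds).eventually (gt_mem_nhds hε)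
  obtain ⟨t, ⟨⟨h1, h2⟩, h3⟩, ht⟩ := (((hlim.eventually
    (hS (ε / (2 * c)) (by positivity))).and hsmall1).and hsmall2).and self_mem_nhdsWithin |>.exists
  have ht : 0 < t := ht
  have hnorm_smul : ‖t • v‖ = t * ‖v‖ := by rw [norm_smul, Real.norm_eq_abs, abs_of_pos ht]
  obtain ⟨z, hz, hzd⟩ := h1 (u + t • v) (by
    rw [mem_closedBall, dist_eq_norm, add_sub_cancel_left, hnorm_smul]
    nlinarith)
  set y := u + t • v with hy
  have hysq : ‖y‖ ^ 2 = 1 + t ^ 2 * ‖v‖ ^ 2 := by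
    rw [hy, norm_add_sq_real, real_inner_smul_right, hv, hnorm_smul, hu]
    ring
  have hy1 : 1 ≤ ‖y‖ := by
    by_contra! hlt
    nlinarith [norm_nonneg y, sq_nonneg (t * ‖v‖)]
  have hy2 : ‖‖y‖⁻¹ • y - y‖ ≤ t ^ 2 * ‖v‖ ^ 2 := by
    have e : ‖y‖⁻¹ • y - y = (‖y‖⁻¹ - 1) • y := by rw [sub_smul, one_smul]
    have hle : ‖y‖⁻¹ ≤ 1 := inv_le_one_of_one_le₀ hy1
    rw [e, norm_smul, Real.norm_eq_abs, abs_of_nonpos (by linarith), neg_sub, sub_mul,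
      inv_mul_cancel₀ (by positivity)]
    nlinarith
  have hzt : ‖z - u - t • v‖ ≤ t * (t * ‖v‖ ^ 2) + t * (ε / 2) := by
    have e : z - u - t • v = (z - ‖y‖⁻¹ • y) + (‖y‖⁻¹ • y - y) := by
      rw [hy]
      abel
    rw [e]
    refine (norm_add_le _ _).trans ?_
    have : ε / (2 * c) * (c * t) = t * (ε / 2) := by field_simp
    linarith
  have hzt' : ‖z - u - t • v‖ < t * ε := by nlinarith
  refine ⟨z, hz, t⁻¹, inv_pos.2 ht, ?_, ?_⟩
  · have := norm_add_le (z - u - t • v) (t • v)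
    rw [sub_add_cancel, hnorm_smul] at this
    linarith
  · have e : t⁻¹ • (z - u) - v = t⁻¹ • (z - u - t • v) := by
      rw [smul_sub t⁻¹ (z - u), smul_smul, inv_mul_cancel₀ ht.ne', one_smul]
    rw [e, norm_smul, norm_inv, Real.norm_eq_abs, abs_of_pos ht, inv_mul_lt_iff₀ ht]
    exact hzt'

theorem IsRegularPoint.approxTangentCone_eq (hA : MeasurableSet A) (hA1 : A ⊆ sphere 0 1)
    (hu : u ∈ A) (h : IsRegularPoint A f u) :
    approxTangentCone (μHE[n - 1].restrict A) (n - 1) u = ((ℝ ∙ u)ᗮ : Submodule ℝ _) := by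
  have hu1 : ‖u‖ = 1 := by simpa using hA1 hu
  ext v
  rw [SetLike.mem_coe, Submodule.mem_orthogonal_singleton_iff_inner_right]
  constructor
  · intro hv
    refine inner_eq_zero_of_mem_tangentCone hA1 hu1 (hv A ?_)
    refine hasDensity_zero_of_eventually (Eventually.of_forall fun r => ?_)
    rw [Measure.restrict_apply measurableSet_ball, Measure.restrict_apply' hA, Set.inter_assoc,
      Set.compl_inter_self, Set.inter_empty, measure_empty]
  · intro hv S hS ε hε
    obtain ⟨x, hx, hr⟩ := (h.2 S hS).mem_tangentCone hu1 hv ε hε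
    exact ⟨x, hx.2, hr⟩

theorem IsRegularPoint.approxTangentSpace_eq (hA : MeasurableSet A) (hA1 : A ⊆ sphere 0 1)
    (hu : u ∈ A) (h : IsRegularPoint A f u) :
    approxTangentSpace (μHE[n - 1].restrict A) (n - 1) u = (ℝ ∙ u)ᗮ := by
  rw [approxTangentSpace, h.approxTangentCone_eq hA hA1 hu, Submodule.span_eq]

/-- A differential within `A` is an approximate differential. -/
theorem hasApproxDerivAt_of_hasFDerivWithinAt {μ : Measure (EuclideanSpace ℝ (Fin n))} {m : ℕ}
    (hA : MeasurableSet A) {ζ : EuclideanSpace ℝ (Fin n) →L[ℝ] EuclideanSpace ℝ (Fin n)}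
    (hf : HasFDerivWithinAt f ζ A u) : HasApproxDerivAt (μ.restrict A) m A f u ζ := by
  refine ⟨f u, fun ε hε => hasDensity_zero_of_eventually ?_⟩
  obtain ⟨δ, hδ, hball⟩ := Metric.mem_nhdsWithin_iff.1 (hf.isLittleO.bound hε)
  filter_upwards [Ioo_mem_nhdsGT hδ] with r hr
  rw [Measure.restrict_apply measurableSet_ball, Measure.restrict_apply' hA]
  convert measure_empty (μ := μ)
  rw [Set.eq_empty_iff_forall_notMem]
  rintro z ⟨⟨hz1, hz2⟩, hz3⟩
  exact hz2 ⟨hz3, hball ⟨ball_subset_ball hr.2.le hz1, hz3⟩⟩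

/-- On the approximate tangent cone, every approximate differential agrees with the differential
within `A`. -/
theorem HasApproxDerivAt.apply_eq {μ : Measure (EuclideanSpace ℝ (Fin n))} {m : ℕ}
    {ζ ζ' : EuclideanSpace ℝ (Fin n) →L[ℝ] EuclideanSpace ℝ (Fin n)}
    (h' : HasApproxDerivAt μ m A f u ζ') (hf : HasFDerivWithinAt f ζ A u)
    (h0 : 0 ∈ approxTangentCone μ m u) {v : EuclideanSpace ℝ (Fin n)}
    (hv : v ∈ approxTangentCone μ m u) : ζ' v = ζ v := by
  obtain ⟨ξ, hξ⟩ := h'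
  -- the affine approximations have the same constant term
  have hξu : ξ = f u := by
    refine eq_of_forall_dist_le fun ε hε => ?_
    have hcont : Tendsto (fun x => ‖f x - f u‖ + ‖ζ' (x - u)‖ + ‖x - u‖) (𝓝[A] u) (𝓝 0) := by
      have h1 : Tendsto (fun x => ‖f x - f u‖) (𝓝[A] u) (𝓝 0) :=
        tendsto_iff_norm_sub_tendsto_zero.1 hf.continuousWithinAt
      have h2 : Tendsto (fun x => ‖ζ' (x - u)‖ + ‖x - u‖) (𝓝 u) (𝓝 (‖ζ' (u - u)‖ + ‖u - u‖)) :=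
        Continuous.tendsto (by fun_prop) u
      rw [sub_self, map_zero, norm_zero, add_zero] at h2
      simpa [add_assoc] using h1.add (h2.mono_left nhdsWithin_le_nhds)
    obtain ⟨δ, hδ, hball⟩ := Metric.mem_nhdsWithin_iff.1 (hcont.eventually (gt_mem_nhds hε))
    obtain ⟨x, ⟨hxA, hx⟩, -, -, hxu, -⟩ := h0 _ (hξ 1 one_pos) δ hδ
    have h3 : ‖f x - f u‖ + ‖ζ' (x - u)‖ + ‖x - u‖ < ε :=
      hball ⟨by rwa [mem_ball, dist_eq_norm], hxA⟩
    rw [dist_eq_norm]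
    have e : ξ - f u = (f x - f u) - (f x - ξ - ζ' (x - u)) - ζ' (x - u) := by abel
    rw [e]
    refine (norm_sub_le _ _).trans ?_
    have := norm_sub_le (f x - f u) (f x - ξ - ζ' (x - u))
    linarith
  subst hξu
  rw [← sub_eq_zero, ← sub_apply, ← norm_le_zero_iff]
  set B := ζ' - ζ with hB
  have main : ∀ ε > 0, ‖B v‖ ≤ ε * (‖B‖ + 2 * (‖v‖ + ε)) := by
    intro ε hε
    obtain ⟨δ, hδ, hball⟩ := Metric.mem_nhdsWithin_iff.1 (hf.isLittleO.bound hε)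
    obtain ⟨x, ⟨hxA, hx⟩, r, hr, hxu, hxv⟩ := hv _ (hξ ε hε) (min δ ε) (lt_min hδ hε)
    have h1 : ‖f x - f u - ζ (x - u)‖ ≤ ε * ‖x - u‖ :=
      hball ⟨by rw [mem_ball, dist_eq_norm]; exact hxu.trans_le (min_le_left _ _), hxA⟩
    have h2 : ‖B (x - u)‖ ≤ 2 * ε * ‖x - u‖ := by
      have e : B (x - u) = (f x - f u - ζ (x - u)) - (f x - f u - ζ' (x - u)) := by
        rw [hB, sub_apply]
        abel
      rw [e]
      refine (norm_sub_le _ _).trans ?_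
      linarith
    have hxv : ‖r • (x - u) - v‖ ≤ ε := hxv.le.trans (min_le_right _ _)
    have h3 : r * ‖x - u‖ ≤ ‖v‖ + ε := by
      have h5 := norm_sub_norm_le (r • (x - u)) v
      rw [norm_smul, Real.norm_eq_abs, abs_of_pos hr] at h5
      linarith
    have e : B v = r • B (x - u) - B (r • (x - u) - v) := by
      rw [map_sub B (r • (x - u)), map_smul, sub_sub_cancel]
    have h4 : ‖r • B (x - u)‖ ≤ 2 * ε * (‖v‖ + ε) := by
      rw [norm_smul, Real.norm_eq_abs, abs_of_pos hr]
      calc r * ‖B (x - u)‖ ≤ r * (2 * ε * ‖x - u‖) := by gcongr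
        _ = 2 * ε * (r * ‖x - u‖) := by ring
        _ ≤ _ := by gcongr
    have h5 : ‖B (r • (x - u) - v)‖ ≤ ‖B‖ * ε := (B.le_opNorm _).trans (by gcongr)
    rw [e]
    refine (norm_sub_le _ _).trans ?_
    linarith
  have hlim : Tendsto (fun ε : ℝ => ε * (‖B‖ + 2 * (‖v‖ + ε))) (𝓝[>] 0) (𝓝 0) := by
    have : Tendsto (fun ε : ℝ => ε * (‖B‖ + 2 * (‖v‖ + ε))) (𝓝 0)
        (𝓝 (0 * (‖B‖ + 2 * (‖v‖ + 0)))) := Continuous.tendsto (by fun_prop) 0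
    rw [zero_mul] at this
    exact this.mono_left nhdsWithin_le_nhds
  exact ge_of_tendsto hlim (by filter_upwards [self_mem_nhdsWithin] with ε hε using main ε hε)

/-- The approximate Jacobian at a regular point of a subset of the sphere, for a map whose
differential within the set is given by a symmetric positive operator with kernel containing `u`. -/
theorem IsRegularPoint.approxJacobian_eq (hA : MeasurableSet A) (hA1 : A ⊆ sphere 0 1)
    (hu : u ∈ A) (h : IsRegularPoint A f u)
    {ζ : EuclideanSpace ℝ (Fin n) →L[ℝ] EuclideanSpace ℝ (Fin n)}
    (hf : HasFDerivWithinAt f ζ A u)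
    (hpos : (ζ : EuclideanSpace ℝ (Fin n) →ₗ[ℝ] EuclideanSpace ℝ (Fin n)).IsPositive)
    (hinv : ∀ v ∈ (ℝ ∙ u)ᗮ, (ζ : EuclideanSpace ℝ (Fin n) →ₗ[ℝ] _) v ∈ (ℝ ∙ u)ᗮ) :
    approxJacobian (μHE[n - 1].restrict A) (n - 1) A f u =
      LinearMap.det ((ζ : EuclideanSpace ℝ (Fin n) →ₗ[ℝ] _).restrict hinv) := by
  have hu0 : u ≠ 0 := by
    rintro rfl
    simpa using hA1 hu
  have hcone := h.approxTangentCone_eq hA hA1 hu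
  have hspace := h.approxTangentSpace_eq hA hA1 hu
  have hdiff : ApproxDifferentiableAt (μHE[n - 1].restrict A) (n - 1) A f u :=
    ⟨ζ, hasApproxDerivAt_of_hasFDerivWithinAt hA hf⟩
  have hfin : Module.finrank ℝ (ℝ ∙ u)ᗮ = n - 1 := by
    have h := Submodule.finrank_add_finrank_orthogonal (ℝ ∙ u)
    rw [finrank_span_singleton hu0, finrank_euclideanSpace_fin] at h
    omega
  have hD : ∀ v : approxTangentSpace (μHE[n - 1].restrict A) (n - 1) u,
      approxDifferential (μHE[n - 1].restrict A) (n - 1) A f u v = ζ v := by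
    intro v
    rw [approxDifferential, dif_pos hdiff]
    refine hdiff.choose_spec.apply_eq hf ?_ ?_
    · rw [hcone]
      exact Submodule.zero_mem _
    · rw [hcone, SetLike.mem_coe, ← hspace]
      exact v.2
  exact exteriorPowerNorm_eq_det hspace hfin hD hpos hinv

/-! ### The inverse Gauss map and the support function -/

variable {K : Set (EuclideanSpace ℝ (Fin n))}

/-- If `A_i` is asymptotically dense in the sphere at `u` and the inverse Gauss map is
differentiable within `A_i` at `u`, then the whole subdifferential of the support function, at
arbitrary points near `u`, is differentiable at `u`. -/
theorem exists_hasSupportPointDeriv (hK : IsCompact K) {i : ℕ} (hi : 1 ≤ i)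
    (hu : u ∈ enclosedSet K i) (hdense : SphereDenseAt (enclosedSet K i) u)
    (hdiff : DifferentiableWithinAt ℝ (inverseGaussMap K) (enclosedSet K i) u) :
    ∃ B, HasSupportPointDeriv K u (inverseGaussMap K u) B := by
  obtain ⟨ζ, hζ⟩ := hdiff
  have hu1 : ‖u‖ = 1 := hu.1
  have hu0 : u ≠ 0 := by
    rintro rfl
    simp at hu1
  -- `N` is the normalization, along whose fibres the support points do not change
  set N : EuclideanSpace ℝ (Fin n) → EuclideanSpace ℝ (Fin n) := fun y => ‖y‖⁻¹ • y with hN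
  have hNu : N u = u := by rw [hN]; simp [hu1]
  have hNd : DifferentiableAt ℝ N u :=
    ((differentiableAt_id.norm ℝ hu0).inv (norm_ne_zero_iff.2 hu0)).smul differentiableAt_id
  obtain ⟨Q, hQ⟩ := hNd
  refine ⟨ζ.comp Q, fun ε hε => ?_⟩
  set T := inverseGaussMap K with hT
  set c : ℝ := 2 * i + ‖Q‖ + 2 + 2 * ‖ζ‖ with hc
  have hc0 : 0 < c := by positivity
  set η : ℝ := min 1 (ε / c) with hη
  have hη0 : 0 < η := lt_min one_pos (by positivity)
  have hη1 : η ≤ 1 := min_le_left _ _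
  have hηc : η * c ≤ ε := by
    have : η ≤ ε / c := min_le_right _ _
    rwa [le_div_iff₀ hc0] at this
  obtain ⟨δ, hδ, hball⟩ := Metric.mem_nhdsWithin_iff.1 (hζ.isLittleO.bound hη0)
  obtain ⟨ρ, hρ, hdρ⟩ := mem_nhdsGT_iff_exists_Ioo_subset.1 (hdense η hη0)
  have hρ : 0 < ρ := hρ
  filter_upwards [hQ.isLittleO.bound hη0, ball_mem_nhds u hρ,
    ball_mem_nhds u (show 0 < δ / (‖Q‖ + 2) by positivity)] with y hyQ hyρ hyδ p hp
  rw [hNu] at hyQ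
  rw [mem_ball, dist_eq_norm] at hyρ hyδ
  rcases eq_or_ne y u with rfl | hyu
  · have := norm_sub_inverseGaussMap_le hK hi hu hp
    rw [sub_self, norm_zero, mul_zero] at this
    simpa using this
  set r := ‖y - u‖ with hr
  have hr0 : 0 < r := norm_pos_iff.2 (sub_ne_zero.2 hyu)
  obtain ⟨z, hz, hzy⟩ := hdρ ⟨hr0, hyρ⟩ y (by rw [mem_closedBall, dist_eq_norm])
  have hzy : ‖z - N y‖ ≤ η * r := hzy
  have hNy : ‖N y - u‖ ≤ (‖Q‖ + 1) * r := by
    have h1 := norm_add_le (N y - u - Q (y - u)) (Q (y - u))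
    rw [sub_add_cancel] at h1
    have h2 := Q.le_opNorm (y - u)
    have h3 : η * r ≤ 1 * r := by gcongr
    linarith
  have hzu : ‖z - u‖ ≤ (‖Q‖ + 2) * r := by
    have h1 := norm_add_le (z - N y) (N y - u)
    rw [sub_add_sub_cancel] at h1
    have h3 : η * r ≤ 1 * r := by gcongr
    linarith
  have b1 : ‖p - T z‖ ≤ 2 * i * (η * r) := by
    refine (norm_sub_inverseGaussMap_le hK hi hz
      (hp.smul (inv_nonneg.2 (norm_nonneg y)))).trans ?_
    gcongr
  have b2 : ‖T z - T u - ζ (z - u)‖ ≤ η * ((‖Q‖ + 2) * r) := by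
    have hzδ : z ∈ ball u δ := by
      rw [mem_ball, dist_eq_norm]
      rw [lt_div_iff₀ (by positivity)] at hyδ
      linarith
    have h1 : ‖T z - T u - ζ (z - u)‖ ≤ η * ‖z - u‖ := hball ⟨hzδ, hz⟩
    exact h1.trans (by gcongr)
  have b3 : ‖ζ (z - N y)‖ ≤ ‖ζ‖ * (η * r) := (ζ.le_opNorm _).trans (by gcongr)
  have b4 : ‖ζ (N y - u - Q (y - u))‖ ≤ ‖ζ‖ * (η * r) := (ζ.le_opNorm _).trans (by gcongr)
  -- pass from `p` to `T z`, from `T z` to its linearization, and then from `z` to `N y` to `y`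
  have e : p - T u - (ζ.comp Q) (y - u) = (p - T z) + (T z - T u - ζ (z - u)) + ζ (z - N y)
      + ζ (N y - u - Q (y - u)) := by
    rw [ContinuousLinearMap.comp_apply, map_sub ζ z u, map_sub ζ z (N y),
      map_sub ζ (N y - u) (Q (y - u)), map_sub ζ (N y) u]
    abel
  rw [e]
  calc _ ≤ ‖p - T z‖ + ‖T z - T u - ζ (z - u)‖ + ‖ζ (z - N y)‖ + ‖ζ (N y - u - Q (y - u))‖ :=
        norm_add₄_le
    _ ≤ 2 * i * (η * r) + η * ((‖Q‖ + 2) * r) + ‖ζ‖ * (η * r) + ‖ζ‖ * (η * r) := by gcongr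
    _ = η * c * r := by rw [hc]; ring
    _ ≤ ε * r := by gcongr

theorem HasSupportPointDeriv.hasFDerivWithinAt_inverseGaussMap (hK : IsCompact K)
    {S : Set (EuclideanSpace ℝ (Fin n))} (hS : S ⊆ regularNormals K)
    {B : EuclideanSpace ℝ (Fin n) →L[ℝ] EuclideanSpace ℝ (Fin n)}
    (h : HasSupportPointDeriv K u (inverseGaussMap K u) B) :
    HasFDerivWithinAt (inverseGaussMap K) B S u := by
  refine HasFDerivWithinAt.of_isLittleO (IsLittleO.of_bound fun ε hε => ?_)
  filter_upwards [nhdsWithin_le_nhds (h ε hε), self_mem_nhdsWithin] with y hy hyS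
  exact hy _ (isSupportPoint_inverseGaussMap hK (hS hyS))

end AffineSurface

theorem lemma4p11 {n : ℕ} (hn : 1 ≤ n) (K : ConvexBody (EuclideanSpace ℝ (Fin n)))
    (hK : (interior (K : Set (EuclideanSpace ℝ (Fin n)))).Nonempty) (i : ℕ) (hi : 1 ≤ i) :
    ∀ᵐ u ∂(μHE[n - 1] : Measure (EuclideanSpace ℝ (Fin n))),
      u ∈ AffineSurface.enclosedSet (K : Set (EuclideanSpace ℝ (Fin n))) i →
        u ∈ AffineSurface.regularNormals (K : Set (EuclideanSpace ℝ (Fin n))) ∧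
        u ∈ AffineSurface.secondOrderDiffSet
          (AffineSurface.supportFun (K : Set (EuclideanSpace ℝ (Fin n)))) ∧
        AffineSurface.ApproxTangentConeIsSubspace
          (μHE[n - 1].restrict (AffineSurface.enclosedSet K i)) (n - 1) u ∧
        AffineSurface.ApproxDifferentiableAt
          (μHE[n - 1].restrict (AffineSurface.enclosedSet K i)) (n - 1)
          (AffineSurface.enclosedSet K i) (AffineSurface.inverseGaussMap K) u ∧
        AffineSurface.approxJacobian
            (μHE[n - 1].restrict (AffineSurface.enclosedSet K i)) (n - 1)
            (AffineSurface.enclosedSet K i) (AffineSurface.inverseGaussMap K) u =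
          AffineSurface.curvatureFun K u := by
  open AffineSurface in
  have hKc : IsCompact (K : Set (EuclideanSpace ℝ (Fin n))) := K.isCompact
  have hKne : (K : Set (EuclideanSpace ℝ (Fin n))).Nonempty := K.nonempty
  have hA : MeasurableSet (enclosedSet (K : Set (EuclideanSpace ℝ (Fin n))) i) :=
    (isCompact_enclosedSet hKc hi).measurableSet
  have hA1 : enclosedSet (K : Set (EuclideanSpace ℝ (Fin n))) i ⊆ sphere 0 1 :=
    fun u hu => by simpa using hu.1
  have hreg := enclosedSet_subset_regularNormals hKc hi
  filter_upwards [ae_isRegularPoint hA hA1 (lipschitzOnWith_inverseGaussMap hKc hi)] with u hu huA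
  have h := hu huA
  have hdense : SphereDenseAt (enclosedSet (K : Set (EuclideanSpace ℝ (Fin n))) i) u := by
    have := h.2 Set.univ (hasDensity_zero_of_eventually (Eventually.of_forall fun r => by simp))
    rwa [Set.inter_univ] at this
  obtain ⟨B, hB⟩ := exists_hasSupportPointDeriv hKc hi huA hdense h.1
  have hHess := hB.hasGenHessianAt hKc hKne
  have hF := hB.hasFDerivWithinAt_inverseGaussMap hKc hreg
  have hu0 : u ≠ 0 := by
    rintro rfl
    simpa using hA1 huA
  have hinv : ∀ v ∈ (ℝ ∙ u)ᗮ, (B : EuclideanSpace ℝ (Fin n) →ₗ[ℝ] _) v ∈ (ℝ ∙ u)ᗮ := by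
    intro v _
    rw [Submodule.mem_orthogonal_singleton_iff_inner_right, ← hHess.2.1 u v]
    simp [hB.apply_self hKc hKne]
  refine ⟨hreg huA, ⟨_, hHess⟩, ⟨(ℝ ∙ u)ᗮ, ?_, (h.approxTangentCone_eq hA hA1 huA).symm⟩,
    ⟨B, hasApproxDerivAt_of_hasFDerivWithinAt hA hF⟩, ?_⟩
  · have hfin := Submodule.finrank_add_finrank_orthogonal (ℝ ∙ u)
    rw [finrank_span_singleton hu0, finrank_euclideanSpace_fin] at hfin
    omega
  · rw [h.approxJacobian_eq hA hA1 huA hF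
      ⟨hHess.2.1, fun w => hB.inner_nonneg hKc hKne w⟩ hinv]
    have hg := hHess.genHessian_eq
    rw [curvatureFun, hg, dif_pos hinv]
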